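/- Let $M$ be a smooth supermanifold, with parity denoted by a tilde. On $T^*M$ use natural local coordinates $(x^A,p_A)$, with $\widetilde{x}^A=\widetilde{p}_A=\widetilde{A}$ and transformation law $\bar x^A=\bar x^A(x)$, $\bar p_A=\frac{\partial x^B}{\partial\bar x^A}p_B$, and the canonical Poisson bracket $$\{F,G\}=(-1)^{\widetilde A\widetilde F+\widetilde A}\frac{\partial F}{\partial p_A}\frac{\partial G}{\partial x^A}-(-1)^{\widetilde A\widetilde F}\frac{\partial F}{\partial x^A}\frac{\partial G}{\partial p_A}.$$ The symbol of a vector field $X=X^A\frac{\partial}{\partial x^A}$ is $\chi=X^Ap_A$. An odd Jacobi structure $(S,Q)$ on $M$ consists of an odd function $S$ on $T^*M$, homogeneous of degree two in the fibre coordinates, and an odd vector field $Q$ with symbol $\mathcal Q$, such that $$Q^2=0,\qquad \{\mathcal Q,S\}=0,\qquad \{S,S\}=-2\mathcal Q S.$$ The odd Jacobi bracket on $C^\infty(M)$ is $$[\![f,g]\!]_J=(-1)^{\widetilde f+1}\{\{S,f\},g\}-(-1)^{\widetilde f+1}\{\mathcal Q,fg\},$$ and the Hamiltonian vector field $X_f$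 of a function $f$ is given by $X_f(g)=(-1)^{\widetilde f}[\![f,g]\!]_J-Q(f)g$. It has parity $\widetilde f+1$. All vector fields and functions occurring in sign factors are homogeneous, and $[\cdot,\cdot]$ is the graded commutator of vector fields. Let $(S,Q)$ be an odd Jacobi structure on $M$. (a) For every (homogeneous) vector field $X$ on $M$, with symbol $\chi$, the following are equivalent: 1. $X$ is a Jacobi vector field, that is, $L_XS=\{\chi,S\}=0$ and $L_XQ=\{\chi,\mathcal Q\}=0$. 2. $X([\![f,g]\!]_J)=[\![X(f),g]\!]_J+(-1)^{\widetilde X(\widetilde f+1)}[\![f,X(g)]\!]_J$ for all $f,g\in C^\infty(M)$. 3. $[X,X_f]=(-1)^{\widetilde X}X_{X(f)}$ for all $f\in C^\infty(M)$. (b) For all $f,g\in C^\infty(M)$, $$Q([\![f,g]\!]_J)=[\![Q(f),g]\!]_J+(-1)^{\widetilde f+1}[\![f,Q(g)]\!]_J\qquad\text{and}\qquad [Q,X_f]=-X_{Q(f)}.$$ -/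

import Mathlib

open TopologicalSpace CategoryTheory Opposite
open scoped TensorProduct ContDiff

noncomputable section
namespace SuperGeometry

universe u

set_option linter.unusedSectionVars false

/-! ### Superdomains -/

/-- The algebra `C^∞(V)` of smooth real functions on an open subset `V` of `ℝ^ι`. -/
def SmoothFn {ι : Type} [Fintype ι] (V : Opens (ι → ℝ)) : Subalgebra ℝ (V → ℝ) where
  carrier := {f | ∃ F : (ι → ℝ) → ℝ, ContDiffOn ℝ ∞ F V ∧ ∀ x : V, F x = f x}
  mul_mem' := by
    rintro f g ⟨F, hF, hf⟩ ⟨G, hG, hg⟩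
    exact ⟨F * G, hF.mul hG, fun x => by simp [hf, hg]⟩
  add_mem' := by
    rintro f g ⟨F, hF, hf⟩ ⟨G, hG, hg⟩
    exact ⟨F + G, hF.add hG, fun x => by simp [hf, hg]⟩
  algebraMap_mem' r := ⟨fun _ => r, contDiffOn_const, fun _ => rfl⟩

namespace SmoothFn
variable {ι ι' : Type} [Fintype ι] [Fintype ι']

/-- The extension by zero of a smooth function on `V` to all of `ℝ^ι`. -/
def zeroExt {V : Opens (ι → ℝ)} (f : SmoothFn V) : (ι → ℝ) → ℝ :=
  Function.extend Subtype.val f.1 0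

theorem zeroExt_apply {V : Opens (ι → ℝ)} (f : SmoothFn V) (x : V) : zeroExt f x = f.1 x :=
  Subtype.val_injective.extend_apply _ _ _

theorem contDiffOn_zeroExt {V : Opens (ι → ℝ)} (f : SmoothFn V) : ContDiffOn ℝ ∞ (zeroExt f) V := by
  obtain ⟨F, hF, hf⟩ := f.2
  refine hF.congr fun x hx => ?_
  rw [zeroExt_apply f ⟨x, hx⟩, ← hf]

theorem zeroExt_eventuallyEq {V : Opens (ι → ℝ)} (f : SmoothFn V) {F : (ι → ℝ) → ℝ}
    (hf : ∀ x : V, F x = f.1 x) (x : V) : zeroExt f =ᶠ[nhds x.1] F := by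
  filter_upwards [V.isOpen.mem_nhds x.2] with y hy
  rw [zeroExt_apply f ⟨y, hy⟩, ← hf]

theorem differentiableAt_zeroExt {V : Opens (ι → ℝ)} (f : SmoothFn V) (x : V) :
    DifferentiableAt ℝ (zeroExt f) x :=
  ((contDiffOn_zeroExt f).contDiffAt (V.isOpen.mem_nhds x.2)).differentiableAt (by simp)

/-- Pull-back of smooth functions along a smooth map of open sets. -/
def comap {V : Opens (ι → ℝ)} {V' : Opens (ι' → ℝ)} (φ : (ι' → ℝ) → (ι → ℝ))
    (hφ : ContDiff ℝ ∞ φ) (h : ∀ x ∈ V', φ x ∈ V) : SmoothFn V →ₐ[ℝ] SmoothFn V' where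
  toFun f := ⟨fun x => f.1 ⟨φ x, h x x.2⟩, zeroExt f ∘ φ,
    (contDiffOn_zeroExt f).comp hφ.contDiffOn h, fun x => zeroExt_apply f ⟨φ x, h x x.2⟩⟩
  map_one' := rfl
  map_mul' _ _ := rfl
  map_zero' := rfl
  map_add' _ _ := rfl
  commutes' _ := rfl

/-- The partial derivative `∂f/∂x^a`. -/
def pderiv [DecidableEq ι] {V : Opens (ι → ℝ)} (a : ι) : SmoothFn V →ₗ[ℝ] SmoothFn V where
  toFun f := ⟨fun x => fderiv ℝ (zeroExt f) x (Pi.single a 1),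
    fun x => fderiv ℝ (zeroExt f) x (Pi.single a 1),
    ((contDiffOn_zeroExt f).fderiv_of_isOpen V.isOpen (by simp)).clm_apply contDiffOn_const,
    fun _ => rfl⟩
  map_add' f g := by
    refine Subtype.ext (funext fun x => ?_)
    have : zeroExt (f + g) =ᶠ[nhds x.1] zeroExt f + zeroExt g :=
      zeroExt_eventuallyEq _ (fun y => by simp [zeroExt_apply]) x
    change fderiv ℝ _ x.1 _ = _
    rw [this.fderiv_eq]
    rw [fderiv_add (differentiableAt_zeroExt f x) (differentiableAt_zeroExt g x)]
    rfl
  map_smul' r f := by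
    refine Subtype.ext (funext fun x => ?_)
    have : zeroExt (r • f) =ᶠ[nhds x.1] r • zeroExt f :=
      zeroExt_eventuallyEq _ (fun y => by simp [zeroExt_apply]) x
    change fderiv ℝ _ x.1 _ = _
    rw [this.fderiv_eq]
    rw [fderiv_const_smul (differentiableAt_zeroExt f x)]
    rfl

/-- The coordinate function `x^a`. -/
def coord {V : Opens (ι → ℝ)} (a : ι) : SmoothFn V :=
  ⟨fun x => x.1 a, fun x => x a, by fun_prop, fun _ => rfl⟩

end SmoothFn

/-- The algebra `C^∞(V) ⊗ Λ(ξ^i, i ∈ κ)` of functions on the superdomain with body `V ⊆ ℝ^ι` and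
odd coordinates `ξ^i` indexed by `κ`. -/
def SF {ι : Type} [Fintype ι] (V : Opens (ι → ℝ)) (κ : Type) : Type :=
  SmoothFn V ⊗[ℝ] ExteriorAlgebra ℝ (κ → ℝ)

namespace SF
variable {ι κ : Type} [Fintype ι] [DecidableEq ι] [DecidableEq κ]

instance {V : Opens (ι → ℝ)} : Ring (SF V κ) :=
  inferInstanceAs (Ring (SmoothFn V ⊗[ℝ] ExteriorAlgebra ℝ (κ → ℝ)))

instance {V : Opens (ι → ℝ)} : Algebra ℝ (SF V κ) :=
  inferInstanceAs (Algebra ℝ (SmoothFn V ⊗[ℝ] ExteriorAlgebra ℝ (κ → ℝ)))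

/-- The element `f · λ` for `f ∈ C^∞(V)` and `λ ∈ Λ(ξ^i)`. -/
def tm {V : Opens (ι → ℝ)} (f : SmoothFn V) (l : ExteriorAlgebra ℝ (κ → ℝ)) : SF V κ :=
  f ⊗ₜ[ℝ] l

/-- The parity automorphism `f ↦ (-1)^f̃ f`. -/
def inv {V : Opens (ι → ℝ)} : SF V κ →ₐ[ℝ] SF V κ :=
  Algebra.TensorProduct.map (AlgHom.id ℝ _) CliffordAlgebra.involute

/-- Restriction of functions to a smaller body. -/
def res {V V' : Opens (ι → ℝ)} (h : V' ≤ V) : SF V κ →ₐ[ℝ] SF V' κ :=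
  Algebra.TensorProduct.map (SmoothFn.comap id contDiff_id h) (AlgHom.id ℝ _)

/-- The coordinates: `x^a` (even) for `a ∈ ι`, and `ξ^i` (odd) for `i ∈ κ`. -/
def coord {V : Opens (ι → ℝ)} : ι ⊕ κ → SF V κ
  | .inl a => tm (SmoothFn.coord a) 1
  | .inr i => tm 1 (ExteriorAlgebra.ι ℝ (Pi.single i 1))

/-- The (left) partial derivatives `∂/∂x^a` and `∂/∂ξ^i`. -/
def pd {V : Opens (ι → ℝ)} : ι ⊕ κ → SF V κ →ₗ[ℝ] SF V κ
  | .inl a => LinearMap.rTensor (ExteriorAlgebra ℝ (κ → ℝ)) (SmoothFn.pderiv a)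
  | .inr i => LinearMap.lTensor (SmoothFn V) (CliffordAlgebra.contractLeft (LinearMap.proj i))

/-- `(-1)^{α f̃} f`. -/
def invPow {V : Opens (ι → ℝ)} (α : ZMod 2) : SF V κ →ₐ[ℝ] SF V κ :=
  if α = 0 then AlgHom.id ℝ _ else inv

end SF

/-- The parity `Ã` of the coordinate with index `A`. -/
def idxParity {ι κ : Type} : ι ⊕ κ → ZMod 2
  | .inl _ => 0
  | .inr _ => 1

/-! ### The cotangent bundle of a superdomain

If `V ⊆ ℝ^ι` is the body of a superdomain with coordinates `x^A`, `A ∈ ι ⊕ κ`, its cotangent bundle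
is the superdomain with body `V × ℝ^ι ⊆ ℝ^(ι ⊕ ι)` and odd coordinates indexed by `κ ⊕ κ`, the
coordinates being `x^A` (the left copies) and the momenta `p_A` (the right copies). -/

/-- The body of the cotangent bundle. -/
def cot {ι : Type} (V : Opens (ι → ℝ)) : Opens (ι ⊕ ι → ℝ) :=
  ⟨{z | z ∘ Sum.inl ∈ V}, V.isOpen.preimage (by fun_prop)⟩

/-- The index of `x^A` among the coordinates `(x^A, p_A)`. -/
def xIdx {ι κ : Type} (A : ι ⊕ κ) : (ι ⊕ ι) ⊕ (κ ⊕ κ) := Sum.map Sum.inl Sum.inl A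

/-- The index of `p_A` among the coordinates `(x^A, p_A)`. -/
def pIdx {ι κ : Type} (A : ι ⊕ κ) : (ι ⊕ ι) ⊕ (κ ⊕ κ) := Sum.map Sum.inr Sum.inr A

namespace SF
variable {ι κ : Type} [Fintype ι] [DecidableEq ι] [Fintype κ] [DecidableEq κ]

/-- Pull-back of functions to the cotangent bundle. -/
def pullCot {V : Opens (ι → ℝ)} : SF V κ →ₐ[ℝ] SF (cot V) (κ ⊕ κ) :=
  Algebra.TensorProduct.map
    (SmoothFn.comap (fun z => z ∘ Sum.inl) (contDiff_pi.2 fun _ => contDiff_apply _ _ _)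
      fun _ h => h)
    (ExteriorAlgebra.map (Function.ExtendByZero.linearMap ℝ Sum.inl))

/-- The canonical Poisson bracket
`{F, G} = (-1)^(ÃF̃ + Ã) ∂F/∂p_A ∂G/∂x^A - (-1)^(ÃF̃) ∂F/∂x^A ∂G/∂p_A`
(summed over `A`, and extended bilinearly to inhomogeneous `F`). -/
def poisson {V : Opens (ι → ℝ)} (F G : SF (cot V) (κ ⊕ κ)) : SF (cot V) (κ ⊕ κ) :=
  ∑ A : ι ⊕ κ,
    ((-1 : ℤˣ) ^ idxParity A • (pd (pIdx A) (invPow (idxParity A) F) * pd (xIdx A) G) -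
      pd (xIdx A) (invPow (idxParity A) F) * pd (pIdx A) G)

end SF

/-! ### Supermanifolds -/

/-- A topological space with a sheaf of supercommutative real algebras. The `ℤ/2`-grading of the
sheaf is given by its parity automorphism `f ↦ (-1)^f̃ f`, an involution whose eigenspaces for
`1` and `-1` are the even and the odd elements. -/
structure SuperSpace where
  space : TopCat.{u}
  sheaf : TopCat.Sheaf (AlgCat.{u} ℝ) space
  parity : sheaf.obj ⟶ sheaf.obj
  parity_parity : parity ≫ parity = 𝟙 _
  supercomm : ∀ (U : Opens space) (α β : ZMod 2) (f g : sheaf.obj.obj (op U)),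
    (parity.app (op U)).hom f = (-1 : ℤˣ) ^ α • f →
    (parity.app (op U)).hom g = (-1 : ℤˣ) ^ β • g →
      f * g = (-1 : ℤˣ) ^ (α * β) • (g * f)

namespace SuperSpace
variable (M : SuperSpace.{u})

/-- Sections of the structure sheaf over `U`. -/
def Fun (U : Opens M.space) : Type u := M.sheaf.obj.obj (op U)

instance (U : Opens M.space) : Ring (M.Fun U) := inferInstanceAs (Ring (M.sheaf.obj.obj (op U)))

instance (U : Opens M.space) : Algebra ℝ (M.Fun U) :=
  inferInstanceAs (Algebra ℝ (M.sheaf.obj.obj (op U)))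

variable {M}

/-- Restriction of sections. -/
def res {U U' : Opens M.space} (h : U' ≤ U) : M.Fun U →ₐ[ℝ] M.Fun U' :=
  (M.sheaf.obj.map (homOfLE h).op).hom

/-- The parity automorphism `f ↦ (-1)^f̃ f`. -/
def inv {U : Opens M.space} : M.Fun U →ₐ[ℝ] M.Fun U := (M.parity.app (op U)).hom

/-- `f` is homogeneous of parity `α`. -/
def HasParity {U : Opens M.space} (α : ZMod 2) (f : M.Fun U) : Prop :=
  inv f = (-1 : ℤˣ) ^ α • f

end SuperSpace

/-- The source of a chart of the underlying space. -/
def source {X : TopCat.{u}} {m : ℕ} (φ : OpenPartialHomeomorph X (Fin m → ℝ)) : Opens X :=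
  ⟨φ.source, φ.open_source⟩

/-- The image of an open set `W` under a chart of the underlying space. -/
def img {X : TopCat.{u}} {m : ℕ} (φ : OpenPartialHomeomorph X (Fin m → ℝ)) (W : Opens X) :
    Opens (Fin m → ℝ) :=
  ⟨φ.target ∩ φ.symm ⁻¹' W, φ.symm.isOpen_inter_preimage W.isOpen⟩

theorem img_mono {X : TopCat.{u}} {m : ℕ} (φ : OpenPartialHomeomorph X (Fin m → ℝ))
    {W W' : Opens X} (h : W' ≤ W) : img φ W' ≤ img φ W :=
  fun _ hx => ⟨hx.1, h hx.2⟩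

open SuperSpace in
/-- A chart of dimension `m|n`: an isomorphism of an open part of `M` with an open subset of the
standard superspace `ℝ^{m|n}`, the latter with the sheaf `C^∞ ⊗ Λ(ξ^1, …, ξ^n)`. -/
structure Chart (M : SuperSpace.{u}) (m n : ℕ) where
  φ : OpenPartialHomeomorph M.space (Fin m → ℝ)
  e : ∀ W : Opens M.space, W ≤ source φ → M.Fun W ≃ₐ[ℝ] SF (img φ W) (Fin n)
  e_res : ∀ (W W' : Opens M.space) (hW : W ≤ source φ) (h : W' ≤ W)
    (f : M.Fun W), e W' (h.trans hW) (res h f) = SF.res (img_mono φ h) (e W hW f)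
  e_inv : ∀ (W : Opens M.space) (hW : W ≤ source φ) (f : M.Fun W),
    e W hW (SuperSpace.inv f) = SF.inv (e W hW f)

namespace Chart
open SuperSpace
variable {M : SuperSpace.{u}} {m n : ℕ} (c : Chart M m n)

/-- The domain of a chart. -/
abbrev dom : Opens M.space := source c.φ

/-- The local coordinates `x^A`. -/
def x (A : Fin m ⊕ Fin n) : M.Fun c.dom := (c.e c.dom le_rfl).symm (SF.coord A)

/-- The partial derivatives `∂/∂x^A` on functions on `W`. -/
def pd {W : Opens M.space} (hW : W ≤ c.dom) (A : Fin m ⊕ Fin n) : M.Fun W →ₗ[ℝ] M.Fun W :=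
  (c.e W hW).symm.toLinearMap ∘ₗ SF.pd A ∘ₗ (c.e W hW).toLinearMap

/-- Functions on `T^*W` in the natural coordinates `(x^A, p_A)` given by the chart. -/
abbrev CotFun (W : Opens M.space) : Type := SF (cot (img c.φ W)) (Fin n ⊕ Fin n)

/-- Pull-back of functions on `W` to functions on `T^*W`. -/
def pull {W : Opens M.space} (hW : W ≤ c.dom) : M.Fun W →ₐ[ℝ] c.CotFun W :=
  SF.pullCot.comp (c.e W hW).toAlgHom

/-- The momenta `p_A`. -/
def p {W : Opens M.space} (A : Fin m ⊕ Fin n) : c.CotFun W := SF.coord (pIdx A)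

/-- Restriction of functions on the cotangent bundle to a smaller base. -/
def cotRes {W W' : Opens M.space} (h : W' ≤ W) : c.CotFun W →ₐ[ℝ] c.CotFun W' :=
  SF.res fun _ hz => img_mono c.φ h hz

end Chart

/-- A smooth supermanifold of dimension `m|n`. -/
structure Supermanifold (m n : ℕ) extends SuperSpace.{u} where
  t2 : T2Space space
  secondCountable : SecondCountableTopology space
  exists_chart : ∀ x : space, ∃ c : Chart toSuperSpace m n, x ∈ c.dom

namespace Supermanifold
open SuperSpace
variable {m n : ℕ} (M : Supermanifold.{u} m n)

/-- The algebra `C^∞(M)`. -/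
abbrev C : Type u := M.Fun ⊤

/-- The charts of `M`. -/
abbrev Charts : Type u := Chart M.toSuperSpace m n

/-- Families consisting of one function on `T^*U` for each chart with domain `U`. A function on
`T^*M` is treated as the family of its local expressions in natural coordinates. -/
abbrev CotFam : Type u := ∀ c : M.Charts, c.CotFun c.dom

variable {M}

/-- The family `F` consists of the local expressions of a function on `T^*M`: the expressions in
charts `c`, `c'` correspond to each other under the coordinate transformation
`x̄ = x̄(x)`, `p̄_A = (∂x^B/∂x̄^A) p_B` of the cotangent bundle. -/
def IsCotangentFunction (F : M.CotFam) : Prop :=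
  ∀ c c' : M.Charts,
    ∃ τ : c'.CotFun (c.dom ⊓ c'.dom) →ₐ[ℝ] c.CotFun (c.dom ⊓ c'.dom),
      (∀ f, τ (c'.pull inf_le_right f) = c.pull inf_le_left f) ∧
      (∀ A, τ (c'.p A) =
        ∑ B, c.pull inf_le_left (c'.pd inf_le_right A (res inf_le_left (c.x B))) * c.p B) ∧
      τ (c'.cotRes inf_le_right (F c')) = c.cotRes inf_le_left (F c)

/-- The family `F` is odd. -/
def IsOddFam (F : M.CotFam) : Prop := ∀ c, SF.inv (F c) = -F c

/-- The family `F` is (homogeneous) of degree two in the fibre coordinates. -/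
def IsQuadratic (F : M.CotFam) : Prop :=
  ∀ c : M.Charts, ∃ s : Fin m ⊕ Fin n → Fin m ⊕ Fin n → M.Fun c.dom,
    F c = ∑ A, ∑ B, c.pull le_rfl (s A B) * c.p B * c.p A

/-- The canonical Poisson bracket on the cotangent bundle. -/
def poisson (F G : M.CotFam) : M.CotFam := fun c => SF.poisson (F c) (G c)

/-- A function on `M`, considered as a function on `T^*M`. -/
def toCot (f : M.C) : M.CotFam := fun c => c.pull le_rfl (res le_top f)

variable (M) in
/-- A vector field on `M` of parity `ε`: a graded derivation of the structure sheaf. -/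
structure VectorField (ε : ZMod 2) where
  app : ∀ W : Opens M.space, M.Fun W →ₗ[ℝ] M.Fun W
  app_res : ∀ (W W' : Opens M.space) (h : W' ≤ W) (f : M.Fun W),
    app W' (res h f) = res h (app W f)
  parity_app : ∀ (W : Opens M.space) (α : ZMod 2) (f : M.Fun W),
    HasParity α f → HasParity (ε + α) (app W f)
  leibniz : ∀ (W : Opens M.space) (α : ZMod 2) (f g : M.Fun W), HasParity α f →
    app W (f * g) = app W f * g + (-1 : ℤˣ) ^ (ε * α) • (f * app W g)

instance (ε : ZMod 2) : CoeFun (VectorField M ε) fun _ => M.C → M.C := ⟨fun X => X.app ⊤⟩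

/-- The symbol `χ = X^A p_A` of the vector field `X = X^A ∂/∂x^A`. -/
def VectorField.symbol {ε : ZMod 2} (X : VectorField M ε) : M.CotFam :=
  fun c => ∑ A, c.pull le_rfl (X.app c.dom (c.x A)) * c.p A

variable (M) in
/-- An odd Jacobi structure `(S, Q)` on `M`. -/
structure OddJacobiStructure where
  S : M.CotFam
  isCotangentFunction_S : IsCotangentFunction S
  odd_S : IsOddFam S
  quadratic_S : IsQuadratic S
  Q : VectorField M 1
  homological : ∀ (W : Opens M.space) (f : M.Fun W), Q.app W (Q.app W f) = 0
  invariance : poisson Q.symbol S = 0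
  compatibility : poisson S S = -2 * Q.symbol * S

end Supermanifold

/-! ### Calculus on superdomains -/

theorem contractLeft_mul {W : Type} [AddCommGroup W] [Module ℝ W] (d : Module.Dual ℝ W)
    (a b : ExteriorAlgebra ℝ W) :
    CliffordAlgebra.contractLeft d (a * b) =
      CliffordAlgebra.contractLeft d a * b +
        CliffordAlgebra.involute a * CliffordAlgebra.contractLeft d b := by
  induction a using CliffordAlgebra.left_induction with
  | algebraMap r =>
    rw [CliffordAlgebra.contractLeft_algebraMap_mul, CliffordAlgebra.contractLeft_algebraMap,
      zero_mul, zero_add, AlgHom.commutes]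
  | add x y hx hy => simp only [add_mul, map_add, hx, hy]; abel
  | ι_mul x v hx =>
    rw [mul_assoc, CliffordAlgebra.contractLeft_ι_mul, hx, CliffordAlgebra.contractLeft_ι_mul,
      map_mul, CliffordAlgebra.involute_ι]
    simp only [mul_add, sub_mul, smul_mul_assoc, neg_mul, mul_assoc]
    abel

theorem ι_mul_comm {W : Type} [AddCommGroup W] [Module ℝ W] (v : W) (b : ExteriorAlgebra ℝ W) :
    ExteriorAlgebra.ι ℝ v * b = CliffordAlgebra.involute b * ExteriorAlgebra.ι ℝ v := by
  induction b using CliffordAlgebra.left_induction with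
  | algebraMap r => rw [AlgHom.commutes, Algebra.commutes]
  | add x y hx hy => simp only [add_mul, mul_add, map_add, hx, hy]
  | ι_mul x w hx =>
    have h : ExteriorAlgebra.ι ℝ v * ExteriorAlgebra.ι ℝ w =
        -(ExteriorAlgebra.ι ℝ w * ExteriorAlgebra.ι ℝ v) :=
      eq_neg_of_add_eq_zero_left (ExteriorAlgebra.ι_add_mul_swap v w)
    rw [map_mul, CliffordAlgebra.involute_ι]
    change ExteriorAlgebra.ι ℝ v * (ExteriorAlgebra.ι ℝ w * x) = _
    rw [← mul_assoc, h, mul_assoc, neg_mul, mul_assoc, ← hx]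
    simp

theorem two_mul_comm {W : Type} [AddCommGroup W] [Module ℝ W] (a b : ExteriorAlgebra ℝ W) :
    a * b + a * b = b * (a + CliffordAlgebra.involute a) +
      CliffordAlgebra.involute b * (a - CliffordAlgebra.involute a) := by
  induction a using CliffordAlgebra.left_induction generalizing b with
  | algebraMap r =>
    rw [AlgHom.commutes, sub_self, mul_zero, add_zero, mul_add, Algebra.commutes]
  | add x y hx hy =>
    rw [add_mul, add_add_add_comm, hx, hy, map_add]
    simp only [mul_add, mul_sub]
    abel
  | ι_mul x v hx =>
    have h := congrArg (ExteriorAlgebra.ι ℝ v * ·) (hx b)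
    simp only [mul_add, mul_sub] at h
    simp only [← mul_assoc] at h
    rw [ι_mul_comm v b, ι_mul_comm v (CliffordAlgebra.involute b),
      CliffordAlgebra.involute_involute] at h
    change ExteriorAlgebra.ι ℝ v * x * b + ExteriorAlgebra.ι ℝ v * x * b =
      b * (ExteriorAlgebra.ι ℝ v * x + CliffordAlgebra.involute (ExteriorAlgebra.ι ℝ v * x)) +
        CliffordAlgebra.involute b *
          (ExteriorAlgebra.ι ℝ v * x - CliffordAlgebra.involute (ExteriorAlgebra.ι ℝ v * x))
    have hv : CliffordAlgebra.involute (ExteriorAlgebra.ι ℝ v * x) =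
        -(ExteriorAlgebra.ι ℝ v * CliffordAlgebra.involute x) := by
      rw [map_mul, ← neg_mul]
      congr 1
      exact CliffordAlgebra.involute_ι v
    rw [h, hv]
    simp only [mul_add, mul_sub, mul_neg, ← mul_assoc]
    abel

namespace SmoothFn
variable {ι ι' : Type} [Fintype ι] [Fintype ι'] [DecidableEq ι] [DecidableEq ι']

theorem pderiv_apply {V : Opens (ι → ℝ)} (a : ι) (f : SmoothFn V) {F : (ι → ℝ) → ℝ}
    (hF : ∀ x : V, F x = f.1 x) (x : V) :
    (pderiv a f).1 x = fderiv ℝ F x (Pi.single a 1) := by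
  change fderiv ℝ _ x.1 _ = _
  rw [(zeroExt_eventuallyEq f hF x).fderiv_eq]

theorem pderiv_mul {V : Opens (ι → ℝ)} (a : ι) (f g : SmoothFn V) :
    pderiv a (f * g) = pderiv a f * g + f * pderiv a g := by
  refine Subtype.ext (funext fun x => ?_)
  rw [pderiv_apply a (f * g) (F := zeroExt f * zeroExt g) (fun y => by simp [zeroExt_apply]),
    fderiv_mul (differentiableAt_zeroExt f x) (differentiableAt_zeroExt g x)]
  have h1 : (pderiv a f).1 x = fderiv ℝ (zeroExt f) x (Pi.single a 1) := rfl
  have h2 : (pderiv a g).1 x = fderiv ℝ (zeroExt g) x (Pi.single a 1) := rfl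
  simp [h1, h2, zeroExt_apply]
  ring

theorem pderiv_coord {V : Opens (ι → ℝ)} (a b : ι) :
    pderiv a (coord b : SmoothFn V) = if a = b then 1 else 0 := by
  refine Subtype.ext (funext fun x => ?_)
  rw [pderiv_apply a (coord b) (F := fun x => x b) (fun y => rfl)]
  have : (fun x : ι → ℝ => x b) = ContinuousLinearMap.proj (R := ℝ) (φ := fun _ => ℝ) b := rfl
  rw [this, ContinuousLinearMap.fderiv]
  by_cases h : a = b
  · subst h; simp
  · simp [h, Ne.symm h]

theorem pderiv_res {V V' : Opens (ι → ℝ)} (h : V' ≤ V) (a : ι) (f : SmoothFn V) :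
    pderiv a (comap id contDiff_id h f) = comap id contDiff_id h (pderiv a f) := by
  refine Subtype.ext (funext fun x => ?_)
  rw [pderiv_apply a _ (F := zeroExt f) (fun y => zeroExt_apply f ⟨y, h y.2⟩)]
  rfl

theorem pderiv_cot (V : Opens (ι → ℝ)) (j : ι ⊕ ι) (f : SmoothFn V) :
    pderiv j (comap (V' := cot V) (fun z => z ∘ Sum.inl)
      (contDiff_pi.2 fun _ => contDiff_apply _ _ _) (fun _ h => h) f) =
    Sum.elim (fun a => comap (V' := cot V) (fun z => z ∘ Sum.inl)
      (contDiff_pi.2 fun _ => contDiff_apply _ _ _) (fun _ h => h) (pderiv a f)) 0 j := by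
  refine Subtype.ext (funext fun x => ?_)
  let L : (ι ⊕ ι → ℝ) →L[ℝ] (ι → ℝ) :=
    ContinuousLinearMap.pi fun i => ContinuousLinearMap.proj (Sum.inl i)
  have hF : ∀ y : cot V, (zeroExt f ∘ L) y = (comap (V' := cot V) (fun z => z ∘ Sum.inl)
      (contDiff_pi.2 fun _ => contDiff_apply _ _ _) (fun _ h => h) f).1 y :=
    fun y => zeroExt_apply f ⟨y.1 ∘ Sum.inl, y.2⟩
  have hd : DifferentiableAt ℝ (zeroExt f) (L x.1) :=
    differentiableAt_zeroExt f ⟨x.1 ∘ Sum.inl, x.2⟩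
  rw [pderiv_apply j _ hF,
    fderiv_comp _ hd L.differentiableAt,
    ContinuousLinearMap.fderiv, ContinuousLinearMap.comp_apply]
  rcases j with a | a
  · have : L (Pi.single (Sum.inl a) 1) = Pi.single a 1 := by
      ext i; simp [L, Pi.single_apply]
    rw [this]; rfl
  · have : L (Pi.single (Sum.inr a) 1) = 0 := by
      ext i; simp [L]
    rw [this, map_zero]; rfl

end SmoothFn

theorem parity_cases (α : ZMod 2) : α = 0 ∨ α = 1 := by revert α; decide

theorem neg_one_uzpow_one_smul {A : Type*} [AddCommGroup A] (a : A) :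
    (-1 : ℤˣ) ^ (1 : ZMod 2) • a = -a := by
  rw [uzpow_one, Units.smul_def]; simp

theorem neg_one_uzpow_zero_smul {A : Type*} [AddCommGroup A] (a : A) :
    (-1 : ℤˣ) ^ (0 : ZMod 2) • a = a := by
  rw [uzpow_zero, one_smul]

namespace SF
variable {ι κ : Type} [Fintype ι] [DecidableEq ι] [DecidableEq κ]

@[elab_as_elim]
theorem induction_on {V : Opens (ι → ℝ)} {P : SF V κ → Prop} (f : SF V κ)
    (tm : ∀ g l, P (tm g l)) (add : ∀ f g, P f → P g → P (f + g)) : P f :=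
  TensorProduct.induction_on f (by
    have h := tm 0 0
    rwa [SF.tm, TensorProduct.zero_tmul] at h) tm add

section tm
variable {V V' : Opens (ι → ℝ)} (f g : SmoothFn V) (k l : ExteriorAlgebra ℝ (κ → ℝ))

theorem tm_mul : (tm f k : SF V κ) * tm g l = tm (f * g) (k * l) :=
  Algebra.TensorProduct.tmul_mul_tmul f g k l
theorem one_def : (1 : SF V κ) = tm 1 1 := rfl
theorem add_tm : (tm (f + g) k : SF V κ) = tm f k + tm g k := TensorProduct.add_tmul _ _ _
theorem tm_add : (tm f (k + l) : SF V κ) = tm f k + tm f l := TensorProduct.tmul_add _ _ _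
theorem tm_neg : (tm f (-k) : SF V κ) = -tm f k := TensorProduct.tmul_neg _ _
theorem tm_sub : (tm f (k - l) : SF V κ) = tm f k - tm f l := TensorProduct.tmul_sub _ _ _
theorem zero_tm : (tm 0 k : SF V κ) = 0 := TensorProduct.zero_tmul _ _
theorem tm_zero : (tm f 0 : SF V κ) = 0 := TensorProduct.tmul_zero _ _
theorem tm_smul (r : ℝ) : (tm f (r • k) : SF V κ) = r • tm f k := TensorProduct.tmul_smul _ _ _
theorem smul_tm (r : ℝ) : (tm (r • f) k : SF V κ) = r • tm f k := TensorProduct.smul_tmul' _ _ _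
theorem inv_tm : inv (tm f k : SF V κ) = tm f (CliffordAlgebra.involute k) := rfl
theorem res_tm (h : V' ≤ V) :
    res h (tm f k : SF V κ) = tm (SmoothFn.comap id contDiff_id h f) k := rfl
theorem pd_inl_tm (a : ι) : pd (.inl a) (tm f k : SF V κ) = tm (SmoothFn.pderiv a f) k := rfl
theorem pd_inr_tm (i : κ) : pd (.inr i) (tm f k : SF V κ) =
    tm f (CliffordAlgebra.contractLeft (LinearMap.proj i) k) := rfl

end tm

theorem invPow_zero {V : Opens (ι → ℝ)} (f : SF V κ) : invPow 0 f = f := by simp [invPow]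
theorem invPow_one {V : Opens (ι → ℝ)} (f : SF V κ) : invPow 1 f = inv f := by simp [invPow]

theorem inv_inv {V : Opens (ι → ℝ)} (f : SF V κ) : inv (inv f) = f := by
  induction f using SF.induction_on with
  | tm a b => simp [inv_tm]
  | add x y hx hy => rw [map_add, map_add, hx, hy]

theorem inv_res {V V' : Opens (ι → ℝ)} (h : V' ≤ V) (f : SF V κ) : inv (res h f) = res h (inv f) := by
  induction f using SF.induction_on with
  | tm a b => simp [inv_tm, res_tm]
  | add x y hx hy => simp only [map_add, hx, hy]

theorem invPow_res {V V' : Opens (ι → ℝ)} (α : ZMod 2) (h : V' ≤ V) (f : SF V κ) :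
    invPow α (res h f) = res h (invPow α f) := by
  rcases parity_cases α with rfl | rfl
  · rw [invPow_zero, invPow_zero]
  · rw [invPow_one, invPow_one, inv_res]

theorem invPow_invPow {V : Opens (ι → ℝ)} (α β : ZMod 2) (f : SF V κ) :
    invPow α (invPow β f) = invPow (α + β) f := by
  rcases parity_cases α with rfl | rfl <;> rcases parity_cases β with rfl | rfl
  · simp [invPow_zero]
  · simp [invPow_zero, invPow_one]
  · simp [invPow_zero, invPow_one]
  · have : (1 + 1 : ZMod 2) = 0 := by decide
    rw [this, invPow_zero, invPow_one, invPow_one, inv_inv]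

theorem pd_mul {V : Opens (ι → ℝ)} (A : ι ⊕ κ) (f g : SF V κ) :
    pd A (f * g) = pd A f * g + invPow (idxParity A) f * pd A g := by
  induction f using SF.induction_on with
  | add x y hx hy => simp only [add_mul, map_add, hx, hy]; abel
  | tm a b =>
    induction g using SF.induction_on with
    | add x y hx hy => simp only [mul_add, map_add, hx, hy]; abel
    | tm a' b' =>
      rcases A with i | i
      · simp only [idxParity, invPow_zero, tm_mul, pd_inl_tm, SmoothFn.pderiv_mul, add_tm]
      · simp only [idxParity, invPow_one, inv_tm, tm_mul, pd_inr_tm, contractLeft_mul, tm_add]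

theorem involute_contractLeft {W : Type} [AddCommGroup W] [Module ℝ W] (d : Module.Dual ℝ W)
    (b : ExteriorAlgebra ℝ W) :
    CliffordAlgebra.involute (CliffordAlgebra.contractLeft d b) =
      -CliffordAlgebra.contractLeft d (CliffordAlgebra.involute b) := by
  induction b using CliffordAlgebra.left_induction with
  | algebraMap r => simp [CliffordAlgebra.contractLeft_algebraMap]
  | add x y hx hy => simp only [map_add, hx, hy]; abel
  | ι_mul x v hx =>
    rw [CliffordAlgebra.contractLeft_ι_mul, map_mul, CliffordAlgebra.involute_ι, neg_mul, map_neg,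
      CliffordAlgebra.contractLeft_ι_mul, map_sub, map_smul, map_mul, hx,
      CliffordAlgebra.involute_ι]
    simp

theorem inv_pd {V : Opens (ι → ℝ)} (A : ι ⊕ κ) (f : SF V κ) :
    inv (pd A f) = (-1 : ℤˣ) ^ idxParity A • pd A (inv f) := by
  induction f using SF.induction_on with
  | add x y hx hy => simp only [map_add, hx, hy, smul_add]
  | tm a b =>
    rcases A with i | i
    · simp only [idxParity, neg_one_uzpow_zero_smul, pd_inl_tm, inv_tm]
    · simp only [idxParity, neg_one_uzpow_one_smul, pd_inr_tm, inv_tm, involute_contractLeft,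
        tm_neg]

theorem pd_res {V V' : Opens (ι → ℝ)} (h : V' ≤ V) (A : ι ⊕ κ) (f : SF V κ) :
    pd A (res h f) = res h (pd A f) := by
  induction f using SF.induction_on with
  | add x y hx hy => simp only [map_add, hx, hy]
  | tm a b => rcases A with i | i <;> simp [pd_inl_tm, pd_inr_tm, res_tm, SmoothFn.pderiv_res]

theorem pd_one {V : Opens (ι → ℝ)} (A : ι ⊕ κ) : pd A (1 : SF V κ) = 0 := by
  have h := pd_mul A (1 : SF V κ) 1
  simpa using h

theorem inv_coord {V : Opens (ι → ℝ)} (A : ι ⊕ κ) :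
    inv (coord A : SF V κ) = (-1 : ℤˣ) ^ idxParity A • coord A := by
  rcases A with i | i
  · simp only [idxParity, neg_one_uzpow_zero_smul, coord, inv_tm, map_one]
  · simp only [idxParity, neg_one_uzpow_one_smul, coord, inv_tm, ← tm_neg]
    congr 1
    exact CliffordAlgebra.involute_ι _

theorem pd_coord {V : Opens (ι → ℝ)} (A B : ι ⊕ κ) :
    pd A (coord B : SF V κ) = if A = B then 1 else 0 := by
  rcases A with a | a <;> rcases B with b | b
  · simp only [coord, pd_inl_tm, SmoothFn.pderiv_coord, Sum.inl.injEq]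
    split_ifs
    · rfl
    · exact zero_tm _
  · simp only [coord, pd_inl_tm, reduceCtorEq, if_false]
    have := SmoothFn.pderiv_mul a (1 : SmoothFn V) 1
    have h : SmoothFn.pderiv a (1 : SmoothFn V) = 0 := by
      rwa [mul_one, mul_one, one_mul, left_eq_add] at this
    rw [h, zero_tm]
  · simp only [coord, pd_inr_tm, reduceCtorEq, if_false]
    rw [CliffordAlgebra.contractLeft_one, tm_zero]
  · simp only [coord, pd_inr_tm, Sum.inr.injEq]
    have : CliffordAlgebra.contractLeft (LinearMap.proj a : (κ → ℝ) →ₗ[ℝ] ℝ)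
        (ExteriorAlgebra.ι ℝ (Pi.single b (1 : ℝ))) =
        algebraMap ℝ (ExteriorAlgebra ℝ (κ → ℝ)) ((Pi.single b (1 : ℝ) : κ → ℝ) a) :=
      CliffordAlgebra.contractLeft_ι (Q := (0 : QuadraticForm ℝ (κ → ℝ))) _ _
    rw [this]
    by_cases h : a = b
    · subst h; simp only [Pi.single_eq_same, map_one, if_true]; rfl
    · rw [Pi.single_eq_of_ne h, map_zero, tm_zero, if_neg h]

theorem mul_comm_of_parity {V : Opens (ι → ℝ)} {α : ZMod 2} {a : SF V κ}
    (ha : inv a = (-1 : ℤˣ) ^ α • a) (b : SF V κ) : a * b = invPow α b * a := by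
  have key : ∀ a b : SF V κ, a * b + a * b = b * (a + inv a) + inv b * (a - inv a) := by
    intro a b
    induction a using SF.induction_on with
    | add x y hx hy =>
      rw [add_mul, add_add_add_comm, hx, hy, map_add]
      simp only [mul_add, mul_sub]
      abel
    | tm f x =>
      induction b using SF.induction_on with
      | add z w hz hw =>
        rw [mul_add, add_add_add_comm, hz, hw, map_add]
        simp only [add_mul]
        abel
      | tm g y =>
        have h := congrArg (tm (f * g) : _ → SF V κ) (two_mul_comm x y)
        rw [tm_add, tm_add, mul_comm f g, ← tm_mul, ← tm_mul, ← tm_mul, tm_add, tm_sub, ← inv_tm,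
          ← inv_tm, tm_mul, mul_comm g f, ← tm_mul] at h
        exact h
  have h := key a b
  have h2 : (2 : ℝ) ≠ 0 := two_ne_zero
  rw [← two_smul ℝ (a * b)] at h
  refine smul_right_injective _ h2 ?_
  simp only
  rw [h, ha]
  rcases parity_cases α with rfl | rfl
  · rw [neg_one_uzpow_zero_smul, invPow_zero, sub_self, mul_zero, add_zero, mul_add, two_smul]
  · rw [neg_one_uzpow_one_smul, invPow_one, add_neg_cancel, mul_zero, zero_add, sub_neg_eq_add,
      mul_add, two_smul]

variable [Fintype κ]

theorem contractLeft_map {W W' : Type} [AddCommGroup W] [Module ℝ W] [AddCommGroup W']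
    [Module ℝ W'] (L : W →ₗ[ℝ] W') (d : Module.Dual ℝ W') (b : ExteriorAlgebra ℝ W) :
    CliffordAlgebra.contractLeft d (ExteriorAlgebra.map L b) =
      ExteriorAlgebra.map L (CliffordAlgebra.contractLeft (d ∘ₗ L) b) := by
  induction b using CliffordAlgebra.left_induction with
  | algebraMap r =>
    rw [CliffordAlgebra.contractLeft_algebraMap, map_zero]
    erw [AlgHom.commutes, CliffordAlgebra.contractLeft_algebraMap]
  | add x y hx hy => simp only [map_add, hx, hy]
  | ι_mul x v hx =>
    have h : ExteriorAlgebra.map L (CliffordAlgebra.ι 0 v) = CliffordAlgebra.ι 0 (L v) :=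
      ExteriorAlgebra.map_apply_ι L v
    rw [CliffordAlgebra.contractLeft_ι_mul, map_mul, h, CliffordAlgebra.contractLeft_ι_mul, hx,
      map_sub, map_mul, h, map_smul]
    rfl

theorem involute_map {W W' : Type} [AddCommGroup W] [Module ℝ W] [AddCommGroup W']
    [Module ℝ W'] (L : W →ₗ[ℝ] W') (b : ExteriorAlgebra ℝ W) :
    CliffordAlgebra.involute (ExteriorAlgebra.map L b) =
      ExteriorAlgebra.map L (CliffordAlgebra.involute b) := by
  induction b using CliffordAlgebra.left_induction with
  | algebraMap r => simp
  | add x y hx hy => simp only [map_add, hx, hy]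
  | ι_mul x v hx =>
    have h : ExteriorAlgebra.map L (CliffordAlgebra.ι 0 v) = CliffordAlgebra.ι 0 (L v) :=
      ExteriorAlgebra.map_apply_ι L v
    rw [map_mul, h, map_mul, hx, CliffordAlgebra.involute_ι, map_mul, CliffordAlgebra.involute_ι,
      map_mul, map_neg, h]

theorem pullCot_tm {V : Opens (ι → ℝ)} (f : SmoothFn V) (k : ExteriorAlgebra ℝ (κ → ℝ)) :
    pullCot (tm f k : SF V κ) = tm (SmoothFn.comap (fun z => z ∘ Sum.inl)
      (contDiff_pi.2 fun _ => contDiff_apply _ _ _) (fun _ h => h) f)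
      (ExteriorAlgebra.map (Function.ExtendByZero.linearMap ℝ Sum.inl) k) := rfl

theorem extend_inl (v : κ → ℝ) (i : κ) :
    Function.ExtendByZero.linearMap ℝ (Sum.inl : κ → κ ⊕ κ) v (Sum.inl i) = v i :=
  Sum.inl_injective.extend_apply _ _ _

theorem extend_inr (v : κ → ℝ) (i : κ) :
    Function.ExtendByZero.linearMap ℝ (Sum.inl : κ → κ ⊕ κ) v (Sum.inr i) = 0 :=
  Function.extend_apply' _ _ _ (by simp)

theorem inv_pullCot {V : Opens (ι → ℝ)} (f : SF V κ) : inv (pullCot f) = pullCot (inv f) := by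
  induction f using SF.induction_on with
  | add x y hx hy => simp only [map_add, hx, hy]
  | tm a b => simp only [inv_tm, pullCot_tm, involute_map]

theorem pd_xIdx_pullCot {V : Opens (ι → ℝ)} (A : ι ⊕ κ) (f : SF V κ) :
    pd (xIdx A) (pullCot f) = pullCot (pd A f) := by
  induction f using SF.induction_on with
  | add x y hx hy => simp only [map_add, hx, hy]
  | tm a b =>
    rcases A with i | i
    · simp only [xIdx, Sum.map_inl, pullCot_tm, pd_inl_tm, SmoothFn.pderiv_cot, Sum.elim_inl]
    · simp only [xIdx, Sum.map_inr, pullCot_tm, pd_inr_tm, contractLeft_map]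
      congr 3
      have h : (LinearMap.proj (Sum.inl i) : (κ ⊕ κ → ℝ) →ₗ[ℝ] ℝ) ∘ₗ
          (Function.ExtendByZero.linearMap ℝ Sum.inl) = LinearMap.proj i :=
        LinearMap.ext fun v => extend_inl v i
      rw [h]

theorem pd_pIdx_pullCot {V : Opens (ι → ℝ)} (A : ι ⊕ κ) (f : SF V κ) :
    pd (pIdx A) (pullCot f) = 0 := by
  induction f using SF.induction_on with
  | add x y hx hy => simp only [map_add, hx, hy, add_zero]
  | tm a b =>
    rcases A with i | i
    · simp only [pIdx, Sum.map_inl, pullCot_tm, pd_inl_tm, SmoothFn.pderiv_cot, Sum.elim_inr]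
      exact zero_tm _
    · simp only [pIdx, Sum.map_inr, pullCot_tm, pd_inr_tm, contractLeft_map]
      have h : (LinearMap.proj (Sum.inr i) : (κ ⊕ κ → ℝ) →ₗ[ℝ] ℝ) ∘ₗ
          (Function.ExtendByZero.linearMap ℝ Sum.inl) = 0 :=
        LinearMap.ext fun v => extend_inr v i
      rw [h, map_zero, LinearMap.zero_apply, map_zero, tm_zero]

theorem pullCot_injective {V : Opens (ι → ℝ)} :
    Function.Injective (pullCot : SF V κ →ₐ[ℝ] SF (cot V) (κ ⊕ κ)) := by
  let z : SF (cot V) (κ ⊕ κ) →ₐ[ℝ] SF V κ := Algebra.TensorProduct.map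
    (SmoothFn.comap (fun x => Sum.elim x 0)
      (contDiff_pi.2 fun i => by rcases i with i | i <;> simp <;> fun_prop) (fun _ h => h))
    (ExteriorAlgebra.map (LinearMap.funLeft ℝ ℝ Sum.inl))
  have hz : ∀ f, z (pullCot f) = f := by
    intro f
    induction f using SF.induction_on with
    | add x y hx hy => simp only [map_add, hx, hy]
    | tm a b =>
      have h : ExteriorAlgebra.map (LinearMap.funLeft ℝ ℝ Sum.inl)
          (ExteriorAlgebra.map (Function.ExtendByZero.linearMap ℝ (Sum.inl : κ → κ ⊕ κ)) b) =
          b := by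
        rw [← AlgHom.comp_apply, ExteriorAlgebra.map_comp_map]
        have : LinearMap.funLeft ℝ ℝ Sum.inl ∘ₗ
            Function.ExtendByZero.linearMap ℝ (Sum.inl : κ → κ ⊕ κ) = LinearMap.id :=
          LinearMap.ext fun v => funext fun i => extend_inl v i
        rw [this, ExteriorAlgebra.map_id]
        rfl
      exact congrArg (tm a) h
  exact Function.LeftInverse.injective hz

theorem pullCot_res {V V' : Opens (ι → ℝ)} (h : V' ≤ V) (h' : cot V' ≤ cot V) (f : SF V κ) :
    res h' (pullCot f) = pullCot (res h f) := by
  induction f using SF.induction_on with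
  | add x y hx hy => simp only [map_add, hx, hy]
  | tm a b => rfl

end SF

/-! ### First order Taylor expansion -/

theorem contDiff_integral_nat {E : Type} [NormedAddCommGroup E] [NormedSpace ℝ E]
    [FiniteDimensional ℝ E] (n : ℕ) :
    ∀ {F : Type} [NormedAddCommGroup F] [NormedSpace ℝ F] [CompleteSpace F] (h : E → ℝ → F),
      ContDiff ℝ n (Function.uncurry h) → ContDiff ℝ n fun x => ∫ t in (0 : ℝ)..1, h x t := by
  induction n with
  | zero =>
    intro F _ _ _ h hh
    exact contDiff_zero.2
      (intervalIntegral.continuous_parametric_intervalIntegral_of_continuous' hh.continuous _ _)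
  | succ n ih =>
    intro F _ _ _ h hh
    have hd : Differentiable ℝ (Function.uncurry h) := hh.differentiable (by simp)
    let h' : E → ℝ → E →L[ℝ] F := fun x t =>
      (fderiv ℝ (Function.uncurry h) (x, t)).comp (ContinuousLinearMap.inl ℝ E ℝ)
    have hh' : ContDiff ℝ n (Function.uncurry h') := by
      have h1 : ContDiff ℝ n (fderiv ℝ (Function.uncurry h)) :=
        hh.fderiv_right (by simp)
      exact h1.clm_comp contDiff_const
    have hder : ∀ x t, HasFDerivAt (fun x => h x t) (h' x t) x := by
      intro x t
      exact (hd (x, t)).hasFDerivAt.comp x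
        (hasFDerivAt_prodMk_left (𝕜 := ℝ) x t)
    have key : ∀ x, HasFDerivAt (fun x => ∫ t in (0 : ℝ)..1, h x t)
        (∫ t in (0 : ℝ)..1, h' x t) x := by
      intro x
      obtain ⟨C, hC⟩ := ((isCompact_closedBall x 1).prod (isCompact_Icc (a := (0 : ℝ)) (b := 1))
        ).exists_bound_of_continuousOn hh'.continuous.continuousOn
      have hc : ∀ x, Continuous (h x) := fun x =>
        hh.continuous.comp (Continuous.prodMk_right x)
      have hc' : ∀ x, Continuous (h' x) := fun x =>
        hh'.continuous.comp (Continuous.prodMk_right x)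
      refine intervalIntegral.hasFDerivAt_integral_of_dominated_of_fderiv_le
        (s := Metric.closedBall x 1) (bound := fun _ => C) (F' := h')
        (Metric.closedBall_mem_nhds x one_pos) ?_ ?_ ?_ ?_ ?_ ?_
      · exact Filter.Eventually.of_forall fun y => (hc y).aestronglyMeasurable
      · exact (hc x).intervalIntegrable _ _
      · exact (hc' x).aestronglyMeasurable
      · refine Filter.Eventually.of_forall fun t ht y hy => hC (y, t) ⟨hy, ?_⟩
        rw [Set.uIoc_of_le zero_le_one] at ht
        exact ⟨ht.1.le, ht.2⟩
      · exact intervalIntegrable_const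
      · exact Filter.Eventually.of_forall fun t _ y _ => hder y t
    refine contDiff_succ_iff_hasFDerivAt.2 ⟨_, ih h' hh', key⟩

theorem hadamard_global {ι : Type} [Fintype ι] [DecidableEq ι] (f : (ι → ℝ) → ℝ)
    (hf : ContDiff ℝ ∞ f) (a : ι → ℝ) :
    ∃ g : ι → (ι → ℝ) → ℝ, (∀ b, ContDiff ℝ ∞ (g b)) ∧
      ∀ x, f x = f a + ∑ b, (x b - a b) * g b x := by
  let h : ι → (ι → ℝ) → ℝ → ℝ := fun b x t => fderiv ℝ f (a + t • (x - a)) (Pi.single b 1)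
  have hh : ∀ b, ContDiff ℝ ∞ (Function.uncurry (h b)) := by
    intro b
    have h1 : ContDiff ℝ ∞ (fderiv ℝ f) := hf.fderiv_right (by simp)
    have h2 : ContDiff ℝ ∞ fun q : (ι → ℝ) × ℝ => a + q.2 • (q.1 - a) := by fun_prop
    exact (h1.comp h2).clm_apply contDiff_const
  refine ⟨fun b x => ∫ t in (0 : ℝ)..1, h b x t, fun b => ?_, fun x => ?_⟩
  · exact contDiff_infty.2 fun n => contDiff_integral_nat n _ (contDiff_infty.1 (hh b) n)
  · have hc : ∀ b, Continuous (h b x) := fun b =>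
      (hh b).continuous.comp (Continuous.prodMk_right x)
    have hd : ∀ t : ℝ, HasDerivAt (fun t : ℝ => f (a + t • (x - a)))
        (∑ b, (x b - a b) * h b x t) t := by
      intro t
      have h1 : HasDerivAt (fun t : ℝ => a + t • (x - a)) (x - a) t := by
        simpa using ((hasDerivAt_id t).smul_const (x - a)).const_add a
      have h2 := ((hf.differentiable (by simp)) (a + t • (x - a))).hasFDerivAt.comp_hasDerivAt t h1
      have h3 : fderiv ℝ f (a + t • (x - a)) (x - a) = ∑ b, fderiv ℝ f (a + t • (x - a))
          (Pi.single b ((x - a) b)) := by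
        rw [← map_sum, Finset.univ_sum_single]
      have h4 : ∑ b, (x b - a b) * h b x t = fderiv ℝ f (a + t • (x - a)) (x - a) := by
        rw [h3]
        refine Finset.sum_congr rfl fun b _ => ?_
        have : (Pi.single b ((x - a) b) : ι → ℝ) = (x b - a b) • Pi.single b (1 : ℝ) := by
          rw [← Pi.single_smul]; simp
        rw [this, map_smul]; rfl
      rw [h4]
      exact h2
    have := intervalIntegral.integral_eq_sub_of_hasDerivAt (a := 0) (b := 1) (fun t _ => hd t)
      ((continuous_finsetSum _ fun b _ => continuous_const.mul (hc b)).intervalIntegrable _ _)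
    rw [intervalIntegral.integral_finsetSum (f := fun b t => (x b - a b) * h b x t)
      (fun b _ => (continuous_const.mul (hc b)).intervalIntegrable _ _)] at this
    simp only [intervalIntegral.integral_const_mul, one_smul, zero_smul, add_zero,
      add_sub_cancel] at this
    rw [this]; ring

namespace SmoothFn
variable {ι : Type} [Fintype ι] [DecidableEq ι]

theorem hadamard {V : Opens (ι → ℝ)} (f : SmoothFn V) (a : V) :
    ∃ r > 0, ∀ (V' : Opens (ι → ℝ)) (h : V' ≤ V), (V' : Set (ι → ℝ)) ⊆ Metric.ball a.1 r →
      ∃ g : ι → SmoothFn V', comap id contDiff_id h f =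
        algebraMap ℝ _ (f.1 a) + ∑ b, (coord b - algebraMap ℝ _ (a.1 b)) * g b := by
  obtain ⟨r, hr, hrV⟩ := Metric.isOpen_iff.1 V.isOpen a a.2
  let β : ContDiffBump a.1 := ⟨r / 4, r / 2, by positivity, by linarith⟩
  let F : (ι → ℝ) → ℝ := fun x => β x * zeroExt f x
  have hF : ContDiff ℝ ∞ F := by
    refine contDiff_iff_contDiffAt.2 fun x => ?_
    by_cases hx : x ∈ V
    · exact β.contDiff.contDiffAt.mul
        ((contDiffOn_zeroExt f).contDiffAt (V.isOpen.mem_nhds hx))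
    · have hx' : x ∈ (Metric.closedBall a.1 (r / 2))ᶜ := by
        intro h
        exact hx (hrV (lt_of_le_of_lt (Metric.mem_closedBall.1 h) (by linarith)))
      refine (contDiffAt_const (c := (0 : ℝ))).congr_of_eventuallyEq ?_
      filter_upwards [Metric.isClosed_closedBall.isOpen_compl.mem_nhds hx'] with y hy
      have : β y = 0 := β.zero_of_le_dist (by
        simp only [Set.mem_compl_iff, Metric.mem_closedBall, not_le] at hy
        exact hy.le)
      simp [F, this]
  obtain ⟨g, hg, hfg⟩ := hadamard_global F hF a
  have hβ : ∀ x ∈ Metric.ball a.1 (r / 4), β x = 1 := fun x hx =>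
    β.one_of_mem_closedBall (Metric.ball_subset_closedBall hx)
  refine ⟨r / 4, by positivity, fun V' h hV' =>
    ⟨fun b => ⟨fun x => g b x, g b, (hg b).contDiffOn, fun _ => rfl⟩, ?_⟩⟩
  refine Subtype.ext (funext fun x => ?_)
  have h1 := hfg x
  have ha : F a = f.1 a := by
    simp only [F, hβ a (Metric.mem_ball_self (by positivity)), one_mul, zeroExt_apply]
  have hx : F x = f.1 ⟨x, h x.2⟩ := by
    simp only [F, hβ x (hV' x.2), one_mul]
    exact zeroExt_apply f ⟨x, h x.2⟩
  rw [ha, hx] at h1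
  change f.1 ⟨x, h x.2⟩ = _
  rw [h1]
  simp [coord, Finset.sum_apply]

end SmoothFn

namespace SF
variable {ι κ : Type} [Fintype ι] [DecidableEq ι] [DecidableEq κ]

/-- Evaluation at a point of the body. -/
def ev {V : Opens (ι → ℝ)} (a : V) : SF V κ →ₐ[ℝ] ExteriorAlgebra ℝ (κ → ℝ) :=
  (Algebra.TensorProduct.lid ℝ (ExteriorAlgebra ℝ (κ → ℝ))).toAlgHom.comp
    (Algebra.TensorProduct.map ((Pi.evalAlgHom ℝ (fun _ : V => ℝ) a).comp (SmoothFn V).val)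
      (AlgHom.id ℝ _))

theorem ev_tm {V : Opens (ι → ℝ)} (a : V) (f : SmoothFn V) (k : ExteriorAlgebra ℝ (κ → ℝ)) :
    ev a (tm f k) = f.1 a • k := rfl

theorem ev_res {V V' : Opens (ι → ℝ)} (h : V' ≤ V) (a : V') (f : SF V κ) :
    ev a (res h f) = ev ⟨a, h a.2⟩ f := by
  induction f using SF.induction_on with
  | add x y hx hy => simp only [map_add, hx, hy]
  | tm g k => rfl

theorem eq_zero_of_ev {V : Opens (ι → ℝ)} (f : SF V κ) (h : ∀ a, ev a f = 0) : f = 0 := by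
  let B := Module.Basis.ofVectorSpace ℝ (ExteriorAlgebra ℝ (κ → ℝ))
  have hrep : ∀ f : SF V κ, ∃ G : _ →₀ SmoothFn V, f = G.sum fun j g => tm g (B j) := by
    intro f
    induction f using SF.induction_on with
    | add x y hx hy =>
      obtain ⟨G, rfl⟩ := hx
      obtain ⟨H, rfl⟩ := hy
      exact ⟨G + H, (Finsupp.sum_add_index' (h := fun j g => (tm g (B j) : SF V κ))
        (fun _ => zero_tm _) (fun _ _ _ => add_tm _ _ _)).symm⟩
    | tm g k =>
      refine ⟨(B.repr k).mapRange (fun r => r • g) (zero_smul _ _), ?_⟩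
      rw [Finsupp.sum_mapRange_index (h := fun j g => (tm g (B j) : SF V κ)) (fun _ => zero_tm _)]
      conv_lhs => rw [← B.linearCombination_repr k, Finsupp.linearCombination_apply]
      have : ∀ s : ExteriorAlgebra ℝ (κ → ℝ), (tm g s : SF V κ) = (TensorProduct.mk ℝ _ _ g) s := fun _ => rfl
      rw [this, map_finsuppSum]
      refine Finsupp.sum_congr fun j _ => ?_
      rw [← this, tm_smul, smul_tm]
  obtain ⟨G, rfl⟩ := hrep f
  have hG : G = 0 := by
    refine Finsupp.ext fun j => Subtype.ext (funext fun a => ?_)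
    have h1 := h a
    rw [map_finsuppSum] at h1
    simp only [ev_tm] at h1
    have h2 := congrArg (fun k => B.repr k j) h1
    simp only [Finsupp.sum, map_sum, map_smul, Module.Basis.repr_self, Finsupp.coe_finsetSum,
      Finset.sum_apply, Finsupp.smul_single, smul_eq_mul, mul_one, map_zero,
      Finsupp.coe_zero, Pi.zero_apply] at h2
    by_cases hj : j ∈ G.support
    · rwa [Finset.sum_eq_single j (fun b _ hb => Finsupp.single_eq_of_ne hb.symm)
        (fun h => absurd hj h), Finsupp.single_eq_same] at h2
    · rw [Finsupp.notMem_support_iff.1 hj]; rfl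
  rw [hG, Finsupp.sum_zero_index]

end SF

/-! ### The Poisson bracket with functions on the base -/

namespace SF
variable {ι κ : Type} [Fintype ι] [DecidableEq ι] [DecidableEq κ]

theorem invPow_of_parity {V : Opens (ι → ℝ)} {α : ZMod 2} (β : ZMod 2) {a : SF V κ}
    (ha : inv a = (-1 : ℤˣ) ^ α • a) : invPow β a = (-1 : ℤˣ) ^ (β * α) • a := by
  rcases parity_cases β with rfl | rfl
  · rw [invPow_zero, zero_mul, neg_one_uzpow_zero_smul]
  · rw [invPow_one, one_mul, ha]

theorem inv_pd_of_parity {V : Opens (ι → ℝ)} {α : ZMod 2} {f : SF V κ}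
    (hf : inv f = (-1 : ℤˣ) ^ α • f) (A : ι ⊕ κ) :
    inv (pd A f) = (-1 : ℤˣ) ^ (idxParity A + α) • pd A f := by
  rw [inv_pd, hf, uzpow_add, mul_smul, Units.smul_def ((-1 : ℤˣ) ^ α), map_zsmul,
    ← Units.smul_def]

theorem idxParity_pIdx (A : ι ⊕ κ) : idxParity (pIdx A) = idxParity A := by
  rcases A with a | a <;> rfl

variable [Fintype κ] {V : Opens (ι → ℝ)}

/-- The momentum derivative occurring in the Poisson bracket. -/
def momentumDeriv (A : ι ⊕ κ) (F : SF (cot V) (κ ⊕ κ)) : SF (cot V) (κ ⊕ κ) :=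
  (-1 : ℤˣ) ^ idxParity A • pd (pIdx A) (invPow (idxParity A) F)

theorem momentumDeriv_mul (A : ι ⊕ κ) (F G : SF (cot V) (κ ⊕ κ)) :
    momentumDeriv A (F * G) =
      momentumDeriv A F * invPow (idxParity A) G + F * momentumDeriv A G := by
  have h : idxParity A + idxParity A = 0 := CharTwo.add_self_eq_zero _
  rw [momentumDeriv, map_mul, pd_mul, idxParity_pIdx, invPow_invPow, h, invPow_zero, smul_add,
    momentumDeriv, momentumDeriv, smul_mul_assoc, mul_smul_comm]

theorem momentumDeriv_pullCot (A : ι ⊕ κ) (f : SF V κ) :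
    momentumDeriv A (pullCot f) = 0 := by
  have h : invPow (idxParity A) (pullCot f) = pullCot (invPow (idxParity A) f) := by
    rcases parity_cases (idxParity A) with h | h <;> rw [h]
    · rw [invPow_zero, invPow_zero]
    · rw [invPow_one, invPow_one, inv_pullCot]
  rw [momentumDeriv, h, pd_pIdx_pullCot, smul_zero]

theorem momentumDeriv_p (A B : ι ⊕ κ) :
    momentumDeriv A (coord (pIdx B) : SF (cot V) (κ ⊕ κ)) = if A = B then 1 else 0 := by
  have hinj : (pIdx A = pIdx B) ↔ A = B :=
    (Sum.map_injective.2 ⟨Sum.inr_injective, Sum.inr_injective⟩).eq_iff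
  rw [momentumDeriv, invPow_of_parity _ (inv_coord _), Units.smul_def ((-1 : ℤˣ) ^ (_ * _)),
    map_zsmul, ← Units.smul_def, pd_coord, smul_smul, idxParity_pIdx]
  by_cases h : A = B
  · subst h
    rw [if_pos rfl, if_pos rfl]
    rcases parity_cases (idxParity A) with h | h <;> rw [h] <;> simp
  · rw [if_neg h, if_neg (mt hinj.1 h), smul_zero]

theorem poisson_pullCot (F : SF (cot V) (κ ⊕ κ)) (f : SF V κ) :
    poisson F (pullCot f) = ∑ A, momentumDeriv A F * pullCot (pd A f) := by
  refine Finset.sum_congr rfl fun A _ => ?_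
  rw [pd_pIdx_pullCot, mul_zero, sub_zero, pd_xIdx_pullCot, momentumDeriv, smul_mul_assoc]

theorem momentumDeriv_add (A : ι ⊕ κ) (F G : SF (cot V) (κ ⊕ κ)) :
    momentumDeriv A (F + G) = momentumDeriv A F + momentumDeriv A G := by
  simp only [momentumDeriv, map_add, smul_add]

theorem momentumDeriv_sum {I : Type} (s : Finset I) (A : ι ⊕ κ) (F : I → SF (cot V) (κ ⊕ κ)) :
    momentumDeriv A (∑ i ∈ s, F i) = ∑ i ∈ s, momentumDeriv A (F i) := by
  simp only [momentumDeriv, map_sum, Finset.smul_sum]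

theorem poisson_pullCot_sum {I : Type} (s : Finset I) (F : I → SF (cot V) (κ ⊕ κ)) (f : SF V κ) :
    poisson (∑ i ∈ s, F i) (pullCot f) = ∑ i ∈ s, poisson (F i) (pullCot f) := by
  simp only [poisson_pullCot, momentumDeriv_sum, Finset.sum_mul]
  exact Finset.sum_comm

theorem poisson_pullCot_add (F G : SF (cot V) (κ ⊕ κ)) (f : SF V κ) :
    poisson (F + G) (pullCot f) = poisson F (pullCot f) + poisson G (pullCot f) := by
  simp only [poisson_pullCot, momentumDeriv_add, add_mul, Finset.sum_add_distrib]

theorem poisson_pullCot_pullCot (f g : SF V κ) : poisson (pullCot f) (pullCot g) = 0 := by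
  simp [poisson_pullCot, momentumDeriv_pullCot]

theorem poisson_linear (u : ι ⊕ κ → SF V κ) (f : SF V κ) :
    poisson (∑ A, pullCot (u A) * coord (pIdx A)) (pullCot f) = pullCot (∑ A, u A * pd A f) := by
  rw [poisson_pullCot, map_sum]
  refine Finset.sum_congr rfl fun A _ => ?_
  rw [momentumDeriv_sum, map_mul]
  congr 1
  rw [Finset.sum_eq_single A]
  · rw [momentumDeriv_mul, momentumDeriv_pullCot, momentumDeriv_p, if_pos rfl, zero_mul, zero_add,
      mul_one]
  · intro B _ hB
    rw [momentumDeriv_mul, momentumDeriv_pullCot, momentumDeriv_p, if_neg hB.symm, zero_mul,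
      zero_add, mul_zero]
  · simp

theorem poisson_pullCot_mul {φ : ZMod 2} {f : SF V κ} (hf : inv f = (-1 : ℤˣ) ^ φ • f)
    (F G : SF (cot V) (κ ⊕ κ)) :
    poisson (F * G) (pullCot f) =
      poisson F (pullCot f) * invPow φ G + F * poisson G (pullCot f) := by
  simp only [poisson_pullCot, Finset.sum_mul, Finset.mul_sum, ← Finset.sum_add_distrib]
  refine Finset.sum_congr rfl fun A _ => ?_
  have hA : inv (pullCot (pd A f)) = (-1 : ℤˣ) ^ (idxParity A + φ) • pullCot (pd A f) := by
    rw [inv_pullCot, inv_pd_of_parity hf, Units.smul_def, map_zsmul, ← Units.smul_def]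
  have h2 : φ + φ = 0 := CharTwo.add_self_eq_zero _
  have h := mul_comm_of_parity hA (invPow φ G)
  rw [invPow_invPow, add_assoc, h2, add_zero] at h
  rw [momentumDeriv_mul, add_mul, mul_assoc, ← h, mul_assoc, mul_assoc]

theorem poisson_quadratic {φ ψ α : ZMod 2} {f g : SF V κ} (hf : inv f = (-1 : ℤˣ) ^ φ • f)
    (hg : inv g = (-1 : ℤˣ) ^ ψ • g) (s : SF V κ) {P P' : SF (cot V) (κ ⊕ κ)}
    (hP : inv P' = (-1 : ℤˣ) ^ α • P') {w w' y y' : SF V κ}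
    (hw : poisson P (pullCot f) = pullCot w) (hw' : poisson P' (pullCot f) = pullCot w')
    (hy : poisson P (pullCot g) = pullCot y) (hy' : poisson P' (pullCot g) = pullCot y') :
    poisson (poisson (pullCot s * P * P') (pullCot f)) (pullCot g) =
      pullCot (s * ((-1 : ℤˣ) ^ (φ * α) • (w * y') + y * invPow ψ w')) := by
  have hpull : ∀ (β : ZMod 2) (k : SF V κ), invPow β (pullCot k) = pullCot (invPow β k) := by
    intro β k
    rcases parity_cases β with h | h <;> rw [h]
    · rw [invPow_zero, invPow_zero]
    · rw [invPow_one, invPow_one, inv_pullCot]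
  have hz : ∀ (z : ℤˣ) (k : SF V κ), pullCot (z • k) = z • pullCot k := fun z k => by
    rw [Units.smul_def, map_zsmul, ← Units.smul_def]
  rw [poisson_pullCot_mul hf, poisson_pullCot_mul hf, poisson_pullCot_pullCot, zero_mul, zero_add,
    hw, hw', invPow_of_parity φ hP, poisson_pullCot_add]
  have e1 : pullCot s * pullCot w * (-1 : ℤˣ) ^ (φ * α) • P' =
      pullCot ((-1 : ℤˣ) ^ (φ * α) • (s * w)) * P' := by
    rw [hz, map_mul, mul_smul_comm, smul_mul_assoc]
  rw [e1, poisson_pullCot_mul hg, poisson_pullCot_pullCot, zero_mul, zero_add, hy',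
    poisson_pullCot_mul hg (pullCot s * P), poisson_pullCot_mul hg (pullCot s),
    poisson_pullCot_pullCot, poisson_pullCot_pullCot, mul_zero, add_zero, zero_mul, zero_add, hy,
    hpull, mul_add, map_add, mul_smul_comm, hz, hz, smul_mul_assoc, ← map_mul, ← map_mul, ← map_mul,
    mul_assoc, mul_assoc]

end SF

/-! ### Local derivations in a chart -/

namespace SuperSpace
variable {M : SuperSpace.{u}}

theorem res_res {U V W : Opens M.space} (h : V ≤ U) (h' : W ≤ V) (f : M.Fun U) :
    res h' (res h f) = res (h'.trans h) f := by
  change (M.sheaf.obj.map (homOfLE h).op ≫ M.sheaf.obj.map (homOfLE h').op).hom f = _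
  rw [← Functor.map_comp]
  rfl

theorem inv_res {U V : Opens M.space} (h : V ≤ U) (f : M.Fun U) :
    inv (res h f) = res h (inv f) := by
  change (M.sheaf.obj.map (homOfLE h).op ≫ M.parity.app (op V)).hom f = _
  rw [M.parity.naturality]
  rfl

theorem inv_inv {U : Opens M.space} (f : M.Fun U) : inv (inv f) = f := by
  change (M.parity.app (op U) ≫ M.parity.app (op U)).hom f = _
  rw [← NatTrans.comp_app, M.parity_parity]
  rfl

/-- `(-1)^{α f̃} f`. -/
def invPow {U : Opens M.space} (α : ZMod 2) : M.Fun U →ₐ[ℝ] M.Fun U :=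
  if α = 0 then AlgHom.id ℝ _ else inv

theorem invPow_zero {U : Opens M.space} (f : M.Fun U) : invPow 0 f = f := by simp [invPow]
theorem invPow_one {U : Opens M.space} (f : M.Fun U) : invPow 1 f = inv f := by simp [invPow]

theorem invPow_invPow {U : Opens M.space} (α β : ZMod 2) (f : M.Fun U) :
    invPow α (invPow β f) = invPow (α + β) f := by
  rcases parity_cases α with rfl | rfl <;> rcases parity_cases β with rfl | rfl
  · simp [invPow_zero]
  · simp [invPow_zero, invPow_one]
  · simp [invPow_zero, invPow_one]
  · have : (1 + 1 : ZMod 2) = 0 := by decide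
    rw [this, invPow_zero, invPow_one, invPow_one, inv_inv]

theorem invPow_of_parity {U : Opens M.space} {α : ZMod 2} (β : ZMod 2) {a : M.Fun U}
    (ha : HasParity α a) : invPow β a = (-1 : ℤˣ) ^ (β * α) • a := by
  rcases parity_cases β with rfl | rfl
  · rw [invPow_zero, zero_mul, neg_one_uzpow_zero_smul]
  · rw [invPow_one, one_mul, ha]

end SuperSpace

namespace Chart
open SuperSpace
variable {M : SuperSpace.{u}} {m n : ℕ} (c : Chart M m n)

theorem e_invPow {W : Opens M.space} (hW : W ≤ c.dom) (α : ZMod 2) (f : M.Fun W) :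
    c.e W hW (invPow α f) = SF.invPow α (c.e W hW f) := by
  rcases parity_cases α with rfl | rfl
  · rw [invPow_zero, SF.invPow_zero]
  · rw [invPow_one, SF.invPow_one, c.e_inv]

theorem e_pd {W : Opens M.space} (hW : W ≤ c.dom) (A : Fin m ⊕ Fin n) (f : M.Fun W) :
    c.e W hW (c.pd hW A f) = SF.pd A (c.e W hW f) :=
  (c.e W hW).apply_symm_apply _

theorem e_x {W : Opens M.space} (hW : W ≤ c.dom) (A : Fin m ⊕ Fin n) :
    c.e W hW (res hW (c.x A)) = SF.coord A := by
  rw [c.e_res c.dom W le_rfl hW, x, AlgEquiv.apply_symm_apply]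
  rcases A with a | i <;> rfl

theorem e_units_smul {W : Opens M.space} (hW : W ≤ c.dom) (z : ℤˣ) (f : M.Fun W) :
    c.e W hW (z • f) = z • c.e W hW f := by
  rw [Units.smul_def, map_zsmul, ← Units.smul_def]

theorem mul_comm_of_parity {W : Opens M.space} (hW : W ≤ c.dom) {α : ZMod 2} {a : M.Fun W}
    (ha : HasParity α a) (b : M.Fun W) : a * b = invPow α b * a := by
  apply (c.e W hW).injective
  rw [map_mul, map_mul, e_invPow]
  apply SF.mul_comm_of_parity
  rw [← c.e_inv, ha, c.e_units_smul]

theorem pd_mul {W : Opens M.space} (hW : W ≤ c.dom) (A : Fin m ⊕ Fin n) (f g : M.Fun W) :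
    c.pd hW A (f * g) = c.pd hW A f * g + invPow (idxParity A) f * c.pd hW A g := by
  apply (c.e W hW).injective
  rw [e_pd, map_mul, SF.pd_mul, map_add, map_mul, map_mul, e_invPow, e_pd, e_pd]

theorem pd_res {W W' : Opens M.space} (hW : W ≤ c.dom) (h : W' ≤ W) (A : Fin m ⊕ Fin n)
    (f : M.Fun W) : c.pd (h.trans hW) A (res h f) = res h (c.pd hW A f) := by
  apply (c.e W' (h.trans hW)).injective
  rw [e_pd, c.e_res W W' hW h, c.e_res W W' hW h, e_pd, SF.pd_res]

theorem pd_x {W : Opens M.space} (hW : W ≤ c.dom) (A B : Fin m ⊕ Fin n) :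
    c.pd hW A (res hW (c.x B)) = if A = B then 1 else 0 := by
  apply (c.e W hW).injective
  rw [e_pd, e_x, SF.pd_coord]
  split_ifs <;> simp

theorem inv_pd {W : Opens M.space} (hW : W ≤ c.dom) (A : Fin m ⊕ Fin n) (f : M.Fun W) :
    inv (c.pd hW A f) = (-1 : ℤˣ) ^ idxParity A • c.pd hW A (inv f) := by
  apply (c.e W hW).injective
  rw [c.e_inv, e_pd, SF.inv_pd, e_units_smul, e_pd, c.e_inv]

theorem hasParity_x {W : Opens M.space} (hW : W ≤ c.dom) (A : Fin m ⊕ Fin n) :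
    HasParity (idxParity A) (res hW (c.x A)) := by
  apply (c.e W hW).injective
  rw [c.e_inv, e_x, SF.inv_coord, e_units_smul, e_x]

/-- A derivation (of parity `ε`) of the structure sheaf over an open subset of a chart domain
vanishes if it kills the coordinates. -/
theorem derivation_eq_zero {U : Opens M.space} (hU : U ≤ c.dom) (ε : ZMod 2)
    (D : ∀ W ≤ U, M.Fun W →ₗ[ℝ] M.Fun W)
    (hres : ∀ (W W' : Opens M.space) (hW : W ≤ U) (h : W' ≤ W) (f : M.Fun W),
      D W' (h.trans hW) (res h f) = res h (D W hW f))
    (hmul : ∀ (W : Opens M.space) (hW : W ≤ U) (f g : M.Fun W),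
      D W hW (f * g) = D W hW f * g + invPow ε f * D W hW g)
    (hx : ∀ (W : Opens M.space) (hW : W ≤ U) (A : Fin m ⊕ Fin n),
      D W hW (res (hW.trans hU) (c.x A)) = 0)
    (W : Opens M.space) (hW : W ≤ U) (f : M.Fun W) : D W hW f = 0 := by
  have hone : ∀ (W : Opens M.space) (hW : W ≤ U), D W hW 1 = 0 := by
    intro W hW
    have h := hmul W hW 1 1
    rw [mul_one, mul_one, map_one (invPow ε), one_mul] at h
    simpa using h
  have hconst : ∀ (W : Opens M.space) (hW : W ≤ U) (r : ℝ), D W hW (algebraMap ℝ _ r) = 0 := by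
    intro W hW r
    rw [Algebra.algebraMap_eq_smul_one, map_smul, hone, smul_zero]
  -- the exterior generators
  have hext : ∀ (W : Opens M.space) (hW : W ≤ U) (k : ExteriorAlgebra ℝ (Fin n → ℝ)),
      D W hW ((c.e W (hW.trans hU)).symm (SF.tm 1 k)) = 0 := by
    intro W hW k
    induction k using CliffordAlgebra.left_induction with
    | algebraMap r =>
      have : (SF.tm 1 (algebraMap ℝ _ r) : SF (img c.φ W) (Fin n)) = algebraMap ℝ _ r := by
        rw [Algebra.algebraMap_eq_smul_one, Algebra.algebraMap_eq_smul_one, SF.tm_smul]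
        rfl
      erw [this]
      rw [AlgEquiv.commutes, hconst]
    | add x y hx hy =>
      have h := SF.tm_add (1 : SmoothFn (img c.φ W)) x y
      erw [h]
      rw [map_add, map_add, hx, hy, add_zero]
    | ι_mul k v hk =>
      have h1 : (SF.tm 1 (CliffordAlgebra.ι 0 v * k) : SF (img c.φ W) (Fin n)) =
          SF.tm 1 (ExteriorAlgebra.ι ℝ v) * SF.tm 1 k := by
        rw [SF.tm_mul, one_mul]
      have h2 : (SF.tm 1 (ExteriorAlgebra.ι ℝ v) : SF (img c.φ W) (Fin n)) =
          ∑ i, v i • SF.coord (Sum.inr i) := by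
        have hv : v = ∑ i, v i • Pi.single i (1 : ℝ) := by
          conv_lhs => rw [← Finset.univ_sum_single v]
          refine Finset.sum_congr rfl fun i _ => ?_
          rw [← Pi.single_smul]; simp
        have ht : ∀ s, (SF.tm 1 s : SF (img c.φ W) (Fin n)) = TensorProduct.mk ℝ _ _ 1 s :=
          fun _ => rfl
        conv_lhs => rw [hv, map_sum, ht, map_sum]
        refine Finset.sum_congr rfl fun i _ => ?_
        rw [map_smul, map_smul]
        rfl
      erw [h1]
      rw [h2, map_mul, hmul, hk, mul_zero, add_zero, map_sum, map_sum, Finset.sum_mul]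
      refine Finset.sum_eq_zero fun i _ => ?_
      rw [← c.e_x (hW.trans hU), map_smul, AlgEquiv.symm_apply_apply, map_smul, hx, smul_zero,
        zero_mul]
  -- evaluation at a point
  apply (c.e W (hW.trans hU)).injective
  rw [map_zero]
  refine SF.eq_zero_of_ev _ fun a => ?_
  obtain ⟨F, rfl⟩ := (c.e W (hW.trans hU)).symm.surjective f
  induction F using SF.induction_on with
  | add F G hF hG => simp only [map_add, hF, hG, add_zero]
  | tm g k =>
    have hgk : (SF.tm g k : SF (img c.φ W) (Fin n)) = SF.tm g 1 * SF.tm 1 k := by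
      rw [SF.tm_mul, mul_one, one_mul]
    rw [hgk, map_mul, hmul, hext, mul_zero, add_zero, map_mul, map_mul]
    suffices h : SF.ev a (c.e W (hW.trans hU) (D W hW ((c.e W (hW.trans hU)).symm (SF.tm g 1)))) = 0
      by rw [h, zero_mul]
    obtain ⟨r, hr, hg⟩ := SmoothFn.hadamard g a
    let W₀ : Opens M.space := ⟨c.φ.source ∩ c.φ ⁻¹' Metric.ball a.1 r,
      c.φ.isOpen_inter_preimage Metric.isOpen_ball⟩
    have h1 : W ⊓ W₀ ≤ W := inf_le_left
    have hsub : ((img c.φ (W ⊓ W₀) : Opens (Fin m → ℝ)) : Set (Fin m → ℝ)) ⊆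
        Metric.ball a.1 r := by
      rintro y ⟨hy, -, -, hy'⟩
      have : c.φ (c.φ.symm y) ∈ Metric.ball a.1 r := hy'
      rwa [c.φ.right_inv hy] at this
    have ha : a.1 ∈ img c.φ (W ⊓ W₀) := by
      refine ⟨a.2.1, a.2.2, c.φ.map_target a.2.1, ?_⟩
      change c.φ (c.φ.symm a.1) ∈ Metric.ball a.1 r
      rw [c.φ.right_inv a.2.1]
      exact Metric.mem_ball_self hr
    obtain ⟨G, hG⟩ := hg (img c.φ (W ⊓ W₀)) (img_mono c.φ h1) hsub
    have hev : ∀ F : SF (img c.φ W) (Fin n), SF.ev a F =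
        SF.ev (⟨a.1, ha⟩ : img c.φ (W ⊓ W₀)) (SF.res (img_mono c.φ h1) F) :=
      fun F => (SF.ev_res (img_mono c.φ h1) ⟨a.1, ha⟩ F).symm
    have hW₁ : W ⊓ W₀ ≤ U := h1.trans hW
    have hres' : res h1 ((c.e W (hW.trans hU)).symm (SF.tm g 1)) =
        (c.e (W ⊓ W₀) (hW₁.trans hU)).symm (SF.tm (SmoothFn.comap id contDiff_id
          (img_mono c.φ h1) g) 1) := by
      apply (c.e (W ⊓ W₀) (hW₁.trans hU)).injective
      rw [c.e_res W _ (hW.trans hU) h1, AlgEquiv.apply_symm_apply, AlgEquiv.apply_symm_apply]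
      rfl
    have hsum : (SF.tm (SmoothFn.comap id contDiff_id (img_mono c.φ h1) g) 1 :
        SF (img c.φ (W ⊓ W₀)) (Fin n)) = algebraMap ℝ _ (g.1 a) +
          ∑ b, (SF.coord (Sum.inl b) - algebraMap ℝ _ (a.1 b)) * SF.tm (G b) 1 := by
      have ht : ∀ s, (SF.tm s 1 : SF (img c.φ (W ⊓ W₀)) (Fin n)) =
          (Algebra.TensorProduct.includeLeft : SmoothFn (img c.φ (W ⊓ W₀)) →ₐ[ℝ]
            SmoothFn (img c.φ (W ⊓ W₀)) ⊗[ℝ] ExteriorAlgebra ℝ (Fin n → ℝ)) s :=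
        fun _ => rfl
      rw [ht, hG, map_add, map_sum, AlgHom.commutes]
      congr 1
      refine Finset.sum_congr rfl fun b _ => ?_
      rw [map_mul, map_sub, AlgHom.commutes]
      rfl
    rw [hev, ← c.e_res W _ (hW.trans hU) h1, ← hres W _ hW h1, hres', hsum, map_add, map_add,
      AlgEquiv.commutes, hconst, zero_add, map_sum, map_sum, map_sum, map_sum]
    refine Finset.sum_eq_zero fun b _ => ?_
    rw [map_mul, map_sub, AlgEquiv.commutes, hmul, ← c.e_x (hW₁.trans hU),
      AlgEquiv.symm_apply_apply, map_sub, hx, hconst, sub_zero, zero_mul, zero_add, map_mul,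
      map_mul, e_invPow, map_sub, e_x, AlgEquiv.commutes]
    have hinv : SF.invPow ε (SF.coord (Sum.inl b) - algebraMap ℝ _ (a.1 b) :
        SF (img c.φ (W ⊓ W₀)) (Fin n)) = SF.coord (Sum.inl b) - algebraMap ℝ _ (a.1 b) := by
      rw [map_sub, AlgHom.commutes, SF.invPow_of_parity ε (SF.inv_coord _)]
      simp [idxParity]
    have hz : SF.ev (⟨a.1, ha⟩ : img c.φ (W ⊓ W₀)) (SF.coord (Sum.inl b) -
        algebraMap ℝ _ (a.1 b) : SF (img c.φ (W ⊓ W₀)) (Fin n)) = 0 := by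
      rw [map_sub, AlgHom.commutes, SF.coord, SF.ev_tm, Algebra.algebraMap_eq_smul_one]
      exact sub_self _
    rw [hinv, hz, zero_mul]

/-- The local expression `X = X^A ∂/∂x^A` of a derivation of parity `ε`. -/
theorem derivation_eq_sum {U : Opens M.space} (hU : U ≤ c.dom) (ε : ZMod 2)
    (D : ∀ W ≤ U, M.Fun W →ₗ[ℝ] M.Fun W)
    (hres : ∀ (W W' : Opens M.space) (hW : W ≤ U) (h : W' ≤ W) (f : M.Fun W),
      D W' (h.trans hW) (res h f) = res h (D W hW f))
    (hpar : ∀ (W : Opens M.space) (hW : W ≤ U) (α : ZMod 2) (f : M.Fun W),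
      HasParity α f → HasParity (ε + α) (D W hW f))
    (hmul : ∀ (W : Opens M.space) (hW : W ≤ U) (f g : M.Fun W),
      D W hW (f * g) = D W hW f * g + invPow ε f * D W hW g)
    (W : Opens M.space) (hW : W ≤ U) (f : M.Fun W) :
    D W hW f = ∑ A, D W hW (res (hW.trans hU) (c.x A)) * c.pd (hW.trans hU) A f := by
  have key := c.derivation_eq_zero hU ε
    (fun W hW => D W hW - ∑ A, LinearMap.mulLeft ℝ (D W hW (res (hW.trans hU) (c.x A))) ∘ₗ
      c.pd (hW.trans hU) A) ?_ ?_ ?_ W hW f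
  · simpa [sub_eq_zero, LinearMap.sum_apply] using key
  · intro W W' hW h f
    simp only [LinearMap.sub_apply, LinearMap.sum_apply, LinearMap.comp_apply,
      LinearMap.mulLeft_apply, map_sub, map_sum, map_mul]
    rw [hres W W' hW h]
    congr 1
    refine Finset.sum_congr rfl fun A _ => ?_
    rw [← hres W W' hW h, res_res, c.pd_res (hW.trans hU) h]
  · intro W hW f g
    simp only [LinearMap.sub_apply, LinearMap.sum_apply, LinearMap.comp_apply,
      LinearMap.mulLeft_apply, hmul, sub_mul, mul_sub, Finset.sum_mul, Finset.mul_sum]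
    have h : ∀ A, D W hW (res (hW.trans hU) (c.x A)) * c.pd (hW.trans hU) A (f * g) =
        D W hW (res (hW.trans hU) (c.x A)) * c.pd (hW.trans hU) A f * g +
          invPow ε f * (D W hW (res (hW.trans hU) (c.x A)) * c.pd (hW.trans hU) A g) := by
      intro A
      have h1 := c.mul_comm_of_parity (hW.trans hU)
        (hpar W hW _ _ (c.hasParity_x (hW.trans hU) A)) (invPow (idxParity A) f)
      rw [invPow_invPow, add_assoc, CharTwo.add_self_eq_zero, add_zero] at h1
      rw [pd_mul, mul_add, ← mul_assoc, ← mul_assoc, h1, mul_assoc (invPow ε f)]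
    rw [Finset.sum_congr rfl fun A _ => h A, Finset.sum_add_distrib]
    abel
  · intro W hW A
    simp only [LinearMap.sub_apply, LinearMap.sum_apply, LinearMap.comp_apply,
      LinearMap.mulLeft_apply, pd_x]
    simp
end Chart

namespace SF
variable {ι κ : Type} [Fintype ι] [DecidableEq ι] [Fintype κ] [DecidableEq κ]

theorem poisson_res {V V' : Opens (ι → ℝ)} (h : cot V' ≤ cot V) (F G : SF (cot V) (κ ⊕ κ)) :
    poisson (res h F) (res h G) = res h (poisson F G) := by
  simp only [poisson, map_sum, map_sub, invPow_res, pd_res, ← map_mul]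
  refine Finset.sum_congr rfl fun A _ => ?_
  rw [Units.smul_def, Units.smul_def, map_zsmul]

end SF

namespace Chart
open SuperSpace
variable {M : SuperSpace.{u}} {m n : ℕ} (c : Chart M m n)

theorem pull_injective {W : Opens M.space} (hW : W ≤ c.dom) : Function.Injective (c.pull hW) :=
  SF.pullCot_injective.comp (c.e W hW).injective

theorem cotRes_pull {W W' : Opens M.space} (hW : W ≤ c.dom) (h : W' ≤ W) (f : M.Fun W) :
    c.cotRes h (c.pull hW f) = c.pull (h.trans hW) (res h f) := by
  refine (SF.pullCot_res (img_mono c.φ h) _ _).trans ?_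
  exact congrArg SF.pullCot (c.e_res W W' hW h f).symm

theorem cotRes_p {W W' : Opens M.space} (h : W' ≤ W) (A : Fin m ⊕ Fin n) :
    c.cotRes h (c.p A) = c.p A := by
  rcases A with a | i <;> rfl

theorem pull_units_smul {W : Opens M.space} (hW : W ≤ c.dom) (z : ℤˣ) (f : M.Fun W) :
    c.pull hW (z • f) = z • c.pull hW f := by
  rw [Units.smul_def, map_zsmul, ← Units.smul_def]

theorem inv_pull {W : Opens M.space} (hW : W ≤ c.dom) (f : M.Fun W) :
    SF.inv (c.pull hW f) = c.pull hW (SuperSpace.inv f) := by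
  refine (SF.inv_pullCot _).trans ?_
  exact congrArg SF.pullCot (c.e_inv W hW f).symm

theorem poisson_linear {W : Opens M.space} (hW : W ≤ c.dom) (v : Fin m ⊕ Fin n → M.Fun W)
    (f : M.Fun W) : SF.poisson (∑ A, c.pull hW (v A) * c.p A) (c.pull hW f) =
      c.pull hW (∑ A, v A * c.pd hW A f) := by
  refine (SF.poisson_linear (fun A => c.e W hW (v A)) (c.e W hW f)).trans ?_
  simp only [pull, AlgHom.comp_apply]
  congr 1
  change _ = c.e W hW _
  rw [map_sum]
  refine Finset.sum_congr rfl fun A _ => ?_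
  rw [map_mul, e_pd]

/-- The value on `f`, `g` of the bidifferential operator defined by a quadratic function with
coefficients `s`, in terms of the first derivatives `w` of `f` and `y` of `g`. -/
def quad {W : Opens M.space} (φ ψ : ZMod 2) (s : Fin m ⊕ Fin n → Fin m ⊕ Fin n → M.Fun W)
    (w y : Fin m ⊕ Fin n → M.Fun W) : M.Fun W :=
  ∑ A, ∑ B, s A B * ((-1 : ℤˣ) ^ (φ * idxParity A) • (w B * y A) + y B * invPow ψ (w A))

theorem poisson_quadratic {W : Opens M.space} (hW : W ≤ c.dom) {φ ψ : ZMod 2} {f g : M.Fun W}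
    (hf : HasParity φ f) (hg : HasParity ψ g) (s : Fin m ⊕ Fin n → Fin m ⊕ Fin n → M.Fun W)
    (P : Fin m ⊕ Fin n → c.CotFun W) (w y : Fin m ⊕ Fin n → M.Fun W)
    (hP : ∀ A, SF.inv (P A) = (-1 : ℤˣ) ^ idxParity A • P A)
    (hw : ∀ A, SF.poisson (P A) (c.pull hW f) = c.pull hW (w A))
    (hy : ∀ A, SF.poisson (P A) (c.pull hW g) = c.pull hW (y A)) :
    SF.poisson (SF.poisson (∑ A, ∑ B, c.pull hW (s A B) * P B * P A) (c.pull hW f))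
      (c.pull hW g) = c.pull hW (quad φ ψ s w y) := by
  have hf' : SF.inv (c.e W hW f) = (-1 : ℤˣ) ^ φ • c.e W hW f := by
    rw [← c.e_inv, hf, e_units_smul]
  have hg' : SF.inv (c.e W hW g) = (-1 : ℤˣ) ^ ψ • c.e W hW g := by
    rw [← c.e_inv, hg, e_units_smul]
  have hsum : ∀ (k : M.Fun W) (F : Fin m ⊕ Fin n → c.CotFun W),
      SF.poisson (∑ A, F A) (c.pull hW k) = ∑ A, SF.poisson (F A) (c.pull hW k) :=
    fun k F => SF.poisson_pullCot_sum _ F (c.e W hW k)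
  simp only [hsum, quad, map_sum]
  refine Finset.sum_congr rfl fun A _ => Finset.sum_congr rfl fun B _ => ?_
  refine (SF.poisson_quadratic hf' hg' (c.e W hW (s A B)) (hP A)
    (hw B) (hw A) (hy B) (hy A)).trans ?_
  change SF.pullCot _ = SF.pullCot (c.e W hW _)
  congr 1
  rw [map_mul, map_add, map_mul, e_units_smul, map_mul, e_invPow]
  rfl

end Chart

namespace Supermanifold
open SuperSpace
variable {m n : ℕ} {M : Supermanifold.{u} m n}

theorem exists_add_parity {W : Opens M.space} (f : M.Fun W) :
    ∃ f₀ f₁ : M.Fun W, HasParity 0 f₀ ∧ HasParity 1 f₁ ∧ f = f₀ + f₁ := by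
  refine ⟨(2⁻¹ : ℝ) • (f + inv f), (2⁻¹ : ℝ) • (f - inv f), ?_, ?_, ?_⟩
  · rw [HasParity, neg_one_uzpow_zero_smul, map_smul, map_add, inv_inv, add_comm]
  · rw [HasParity, neg_one_uzpow_one_smul, map_smul, map_sub, inv_inv, ← smul_neg, neg_sub]
  · rw [← smul_add, add_add_sub_cancel, ← two_smul ℝ, smul_smul]
    norm_num

theorem VectorField.leibniz' {ε : ZMod 2} (X : VectorField M ε) (W : Opens M.space)
    (f g : M.Fun W) : X.app W (f * g) = X.app W f * g + invPow ε f * X.app W g := by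
  obtain ⟨f₀, f₁, h₀, h₁, rfl⟩ := exists_add_parity f
  rw [add_mul, map_add, X.leibniz W 0 f₀ g h₀, X.leibniz W 1 f₁ g h₁, map_add, map_add,
    invPow_of_parity ε h₀, invPow_of_parity ε h₁]
  simp only [add_mul, smul_mul_assoc]
  abel

theorem VectorField.poisson_symbol {ε : ZMod 2} (X : VectorField M ε) (c : M.Charts)
    (f : M.Fun c.dom) :
    SF.poisson (X.symbol c) (c.pull le_rfl f) = c.pull le_rfl (X.app c.dom f) := by
  rw [VectorField.symbol, c.poisson_linear le_rfl]
  congr 1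
  have h := c.derivation_eq_sum (U := c.dom) le_rfl ε (fun W _ => X.app W)
    (fun W W' _ h f => X.app_res W W' h f) (fun W _ => X.parity_app W)
    (fun W _ => X.leibniz' W) c.dom le_rfl f
  rw [h]
  have hid : ∀ A, res le_rfl (c.x A) = c.x A := by
    intro A
    change (M.sheaf.obj.map (𝟙 _)).hom (c.x A) = _
    rw [CategoryTheory.Functor.map_id]
    rfl
  simp only [hid]

/-- The function `(-1)^(f̃+1) {{S, f}, g} - (-1)^(f̃+1) {𝒬, fg}` on `T^*M`, extended bilinearly to
inhomogeneous `f`: here `inv f` is `(-1)^f̃ f`. -/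
def bracketFam (J : OddJacobiStructure M) (f g : M.C) : M.CotFam :=
  -poisson (poisson J.S (toCot (inv f))) (toCot g) + poisson J.Q.symbol (toCot (inv f * g))

theorem toCot_add (f g : M.C) : toCot (f + g) = toCot f + toCot g := by
  funext c
  simp [toCot]

theorem toCot_injective : Function.Injective (toCot : M.C → M.CotFam) := by
  intro f g h
  have hcov : (⊤ : Opens M.space) ≤ iSup fun c : M.Charts => c.dom := by
    intro x _
    obtain ⟨c, hc⟩ := M.exists_chart x
    exact Opens.mem_iSup.2 ⟨c, hc⟩
  refine TopCat.Sheaf.eq_of_locally_eq' M.sheaf (fun c : M.Charts => c.dom) ⊤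
    (fun c => homOfLE le_top) hcov f g fun c => ?_
  exact c.pull_injective le_rfl (congrFun h c)

theorem poisson_toCot_add (F G : M.CotFam) (f : M.C) :
    poisson (F + G) (toCot f) = poisson F (toCot f) + poisson G (toCot f) :=
  funext fun c => SF.poisson_pullCot_add (F c) (G c) _

theorem poisson_add_toCot (F : M.CotFam) (f g : M.C) :
    poisson F (toCot (f + g)) = poisson F (toCot f) + poisson F (toCot g) := by
  rw [toCot_add]
  funext c
  simp only [poisson, SF.poisson, Pi.add_apply, map_add, mul_add, smul_add,
    ← Finset.sum_add_distrib]
  refine Finset.sum_congr rfl fun A _ => ?_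
  abel

theorem bracketFam_add_left (J : OddJacobiStructure M) (f f' g : M.C) :
    bracketFam J (f + f') g = bracketFam J f g + bracketFam J f' g := by
  rw [bracketFam, map_add, poisson_add_toCot, poisson_toCot_add, add_mul, poisson_add_toCot,
    bracketFam, bracketFam]
  abel

theorem bracketFam_add_right (J : OddJacobiStructure M) (f g g' : M.C) :
    bracketFam J f (g + g') = bracketFam J f g + bracketFam J f g' := by
  rw [bracketFam, poisson_add_toCot, mul_add, poisson_add_toCot, bracketFam, bracketFam]
  abel

theorem HasParity.res' {φ : ZMod 2} {W W' : Opens M.space} (h : W' ≤ W) {f : M.Fun W}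
    (hf : HasParity φ f) : HasParity φ (res h f) := by
  rw [HasParity, inv_res, hf, Units.smul_def, map_zsmul, ← Units.smul_def]

theorem res_units_smul {W W' : Opens M.space} (h : W' ≤ W) (z : ℤˣ) (f : M.Fun W) :
    res h (z • f) = z • res h f := by
  rw [Units.smul_def, map_zsmul, ← Units.smul_def]

theorem res_invPow {W W' : Opens M.space} (h : W' ≤ W) (α : ZMod 2) (f : M.Fun W) :
    res h (invPow α f) = invPow α (res h f) := by
  rcases parity_cases α with rfl | rfl
  · rw [invPow_zero, invPow_zero]
  · rw [invPow_one, invPow_one, inv_res]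

theorem exists_bracket_of_parity (J : OddJacobiStructure M) {φ ψ : ZMod 2} {f g : M.C}
    (hf : HasParity φ f) (hg : HasParity ψ g) : ∃ h : M.C, toCot h = bracketFam J f g := by
  have hf' : HasParity φ (inv f) := by
    rw [HasParity, inv_inv, hf, smul_smul, ← uzpow_add, CharTwo.add_self_eq_zero, uzpow_zero,
      one_smul]
  choose s hs using J.quadratic_S
  let k : ∀ c : M.Charts, M.Fun c.dom := fun c =>
    -Chart.quad φ ψ (s c) (fun A => c.pd le_rfl A (res le_top (inv f)))
      (fun A => c.pd le_rfl A (res le_top g)) + J.Q.app c.dom (res le_top (inv f * g))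
  have hk : ∀ c : M.Charts, c.pull le_rfl (k c) = bracketFam J f g c := by
    intro c
    have hp : ∀ (A : Fin m ⊕ Fin n) (u : M.Fun c.dom), SF.poisson (c.p A) (c.pull le_rfl u) =
        c.pull le_rfl (c.pd le_rfl A u) := by
      intro A u
      have h := c.poisson_linear le_rfl (fun B => if B = A then 1 else 0) u
      simpa [apply_ite (c.pull _), ite_mul] using h
    have h1 := c.poisson_quadratic le_rfl (HasParity.res' le_top hf') (HasParity.res' le_top hg)
      (s c) (fun A => c.p A) _ _ (fun A => (SF.inv_coord _).trans (by rw [SF.idxParity_pIdx]; rfl))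
      (fun A => hp A _) (fun A => hp A _)
    rw [← hs c] at h1
    have h2 := J.Q.poisson_symbol c (res le_top (inv f * g))
    rw [map_add, map_neg, ← h1, ← h2]
    rfl
  have hcompat : ∀ c c' : M.Charts, res (inf_le_left : c.dom ⊓ c'.dom ≤ c.dom) (k c) =
      res (inf_le_right : c.dom ⊓ c'.dom ≤ c'.dom) (k c') := by
    intro c c'
    apply c.pull_injective inf_le_left
    obtain ⟨τ, hτ, hτp, hτS⟩ := J.isCotangentFunction_S c c'
    have hS : c.cotRes inf_le_left (J.S c) = ∑ A, ∑ B,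
        c.pull inf_le_left (res (inf_le_right : c.dom ⊓ c'.dom ≤ c'.dom) (s c' A B)) *
          τ (c'.p B) * τ (c'.p A) := by
      rw [← hτS, hs c']
      simp only [map_sum, map_mul, c'.cotRes_pull, c'.cotRes_p, hτ]
    have hpd : ∀ (A : Fin m ⊕ Fin n) (u : M.Fun (c.dom ⊓ c'.dom)),
        SF.poisson (τ (c'.p A)) (c.pull inf_le_left u) =
          c.pull inf_le_left (c'.pd inf_le_right A u) := by
      intro A u
      rw [hτp, c.poisson_linear]
      congr 1
      exact (c.derivation_eq_sum (U := c.dom ⊓ c'.dom) inf_le_left (idxParity A)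
        (fun W hW => c'.pd (hW.trans inf_le_right) A)
        (fun W W' hW h f => c'.pd_res (hW.trans inf_le_right) h A f)
        (fun W hW α f hf => by
          rw [HasParity, c'.inv_pd, hf, Units.smul_def ((-1 : ℤˣ) ^ α), map_zsmul,
            ← Units.smul_def, uzpow_add, mul_smul])
        (fun W hW f g => c'.pd_mul (hW.trans inf_le_right) A f g) _ le_rfl u).symm
    have hpar : ∀ A, SF.inv (τ (c'.p A)) = (-1 : ℤˣ) ^ idxParity A • τ (c'.p A) := by
      intro A
      rw [hτp, map_sum, Finset.smul_sum]
      refine Finset.sum_congr rfl fun B _ => ?_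
      have hB := c.hasParity_x (inf_le_left : c.dom ⊓ c'.dom ≤ c.dom) B
      have hp : SF.inv (c.p B : c.CotFun (c.dom ⊓ c'.dom)) = (-1 : ℤˣ) ^ idxParity B • c.p B :=
        (SF.inv_coord _).trans (by rw [SF.idxParity_pIdx]; rfl)
      rw [map_mul, c.inv_pull, c'.inv_pd, hB, Units.smul_def ((-1 : ℤˣ) ^ idxParity B), map_zsmul,
        ← Units.smul_def, c.pull_units_smul, c.pull_units_smul, hp, smul_mul_smul_comm]
      rw [smul_mul_assoc, smul_smul, mul_assoc, ← uzpow_add, CharTwo.add_self_eq_zero, uzpow_zero,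
        mul_one]
    have h1 := c.poisson_quadratic inf_le_left (HasParity.res' le_top hf')
      (HasParity.res' le_top hg)
      (fun A B => res (inf_le_right : c.dom ⊓ c'.dom ≤ c'.dom) (s c' A B))
      (fun A => τ (c'.p A)) _ _ hpar (fun A => hpd A _) (fun A => hpd A _)
    rw [← hS] at h1
    have h2 : c.cotRes (inf_le_left : c.dom ⊓ c'.dom ≤ c.dom) (c.pull le_rfl (k c)) =
        -SF.poisson (SF.poisson (c.cotRes inf_le_left (J.S c))
          (c.pull inf_le_left (res le_top (inv f)))) (c.pull inf_le_left (res le_top g)) +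
          c.pull inf_le_left (J.Q.app _ (res le_top (inv f * g))) := by
      have h3 := J.Q.poisson_symbol c (res le_top (inv f * g))
      have hpr : ∀ F G : c.CotFun c.dom,
          SF.poisson (c.cotRes (inf_le_left : c.dom ⊓ c'.dom ≤ c.dom) F) (c.cotRes inf_le_left G) =
            c.cotRes inf_le_left (SF.poisson F G) := fun F G => SF.poisson_res _ F G
      rw [hk c]
      change c.cotRes inf_le_left (-SF.poisson (SF.poisson (J.S c)
        (c.pull le_rfl (res le_top (inv f)))) (c.pull le_rfl (res le_top g)) +
          SF.poisson (J.Q.symbol c) (c.pull le_rfl (res le_top (inv f * g)))) = _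
      rw [h3, map_add, map_neg, ← hpr, ← hpr, c.cotRes_pull, c.cotRes_pull, c.cotRes_pull,
        res_res, res_res, ← J.Q.app_res, res_res]
    rw [← c.cotRes_pull le_rfl, h2, h1, ← map_neg, ← map_add]
    congr 1
    simp only [k, Chart.quad, map_add, map_neg, map_sum, map_mul, ← J.Q.app_res, res_res,
      res_units_smul, res_invPow, ← c'.pd_res]
  have hcov : (⊤ : Opens M.space) ≤ iSup fun c : M.Charts => c.dom := by
    intro x _
    obtain ⟨c, hc⟩ := M.exists_chart x
    exact Opens.mem_iSup.2 ⟨c, hc⟩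
  obtain ⟨h, hh, -⟩ := TopCat.Sheaf.existsUnique_gluing' M.sheaf (fun c : M.Charts => c.dom) ⊤
    (fun c => homOfLE le_top) hcov k (fun c c' => hcompat c c')
  refine ⟨h, funext fun c => ?_⟩
  rw [← hk c]
  exact congrArg (c.pull le_rfl) (hh c)

theorem exists_bracket (J : OddJacobiStructure M) (f g : M.C) :
    ∃ h : M.C, toCot h = bracketFam J f g := by
  obtain ⟨f₀, f₁, hf₀, hf₁, rfl⟩ := exists_add_parity f
  obtain ⟨g₀, g₁, hg₀, hg₁, rfl⟩ := exists_add_parity g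
  obtain ⟨a, ha⟩ := exists_bracket_of_parity J hf₀ hg₀
  obtain ⟨b, hb⟩ := exists_bracket_of_parity J hf₀ hg₁
  obtain ⟨c, hc⟩ := exists_bracket_of_parity J hf₁ hg₀
  obtain ⟨d, hd⟩ := exists_bracket_of_parity J hf₁ hg₁
  refine ⟨(a + b) + (c + d), ?_⟩
  rw [bracketFam_add_left, bracketFam_add_right, bracketFam_add_right, toCot_add, toCot_add,
    toCot_add, ha, hb, hc, hd]

end Supermanifold

namespace Supermanifold
open SuperSpace
variable {m n : ℕ} {M : Supermanifold.{u} m n}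

namespace OddJacobiStructure
variable (J : OddJacobiStructure M)

/-- The odd Jacobi bracket `⟦f, g⟧_J` on `C^∞(M)`: the function on `M` whose pull-back to `T^*M` is
`(-1)^(f̃+1) {{S, f}, g} - (-1)^(f̃+1) {𝒬, fg}`. -/
def bracket (f g : M.C) : M.C := (exists_bracket J f g).choose

theorem toCot_bracket (f g : M.C) : toCot (J.bracket f g) = bracketFam J f g :=
  (exists_bracket J f g).choose_spec

/-- The Hamiltonian vector field `X_f` as an operator on `C^∞(M)`,
`X_f(g) = (-1)^f̃ ⟦f, g⟧_J - Q(f) g`, where `(-1)^f̃ f` is written `inv f`. -/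
def ham (f : M.C) : M.C → M.C := fun g => J.bracket (inv f) g - J.Q f * g

end OddJacobiStructure

/-- `X` is a Jacobi vector field: `L_X S = {χ, S} = 0` and `L_X Q = {χ, 𝒬} = 0`, where `χ` and `𝒬`
are the symbols of `X` and `Q`. -/
def VectorField.IsJacobi {ε : ZMod 2} (X : VectorField M ε) (J : OddJacobiStructure M) : Prop :=
  poisson X.symbol J.S = 0 ∧ poisson X.symbol J.Q.symbol = 0

/-- The graded commutator `X ∘ Y - (-1)^(X̃ Ỹ) Y ∘ X` of operators on `C^∞(M)` of parities
`X̃ = ε` and `Ỹ = δ`. -/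
def commutator (ε δ : ZMod 2) (X Y : M.C → M.C) : M.C → M.C :=
  fun g => X (Y g) - (-1 : ℤˣ) ^ (ε * δ) • Y (X g)

end Supermanifold
end SuperGeometry
end

/-!
Write `χ` and `𝒬` for the symbols of `X` and `Q`, and put `T = {χ, S}` and `R = {χ, 𝒬}`. Since
`X(f) = {χ, f}`, the graded Jacobi identity shows that the failures of the derivation property of
the bracket and of the commutator formula for Hamiltonian vector fields, evaluated on `f` and `g`,
are
`(-1)^(f̃+1) ({{T, f}, g} - {R, fg})` and `-{{T, f}, g} + (-1)^((X̃+1)f̃) f {R, g}`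
respectively (`OddJacobiStructure.toCot_bracket_defect`, `OddJacobiStructure.toCot_ham_defect`).
Both vanish if `X` is a Jacobi vector field. Conversely, if one of them vanishes for all functions,
a constant argument gives `{R, f} = 0` for all `f`, and then `{{T, f}, g} = 0` for all `f`, `g`.

It remains to see that this forces `R = 0` and `T = 0`. Sections over a chart domain extend, after
shrinking, to global functions (`Supermanifold.exists_global_eq_near`, with a bump function), so
brackets with the local coordinates `x^A` vanish as well; these brackets are the derivatives with
respect to the momenta, and `R` and `T` are homogeneous of degree one and two in the momenta, so
that Euler's identity applies (`SF.HasDegree.eq_zero`).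

The statements on `Q` follow because `Q` is itself a Jacobi vector field: `{𝒬, S} = 0` is part of
the structure and `{𝒬, 𝒬}` is the symbol of `[Q, Q] = 2 Q² = 0`.

The Jacobi identity is only needed with a function `h` of the base as the last argument
(`SF.poisson_jacobi_pullCot`). It is proved by expanding `{G, h} = ∑ ∂G/∂p_B ∂h/∂x^B`, where
`∂G/∂p_B` is the right derivative `SF.momentumDeriv`: this is a right derivation of the Poisson
bracket (`SF.momentumDeriv_poisson`), and the terms with second derivatives of `h` cancel by
symmetry.
-/

noncomputable section
namespace SuperGeometry
universe u

set_option linter.unusedSectionVars false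

/-! ### Graded commutation of partial derivatives -/

theorem SmoothFn.pderiv_comm {ι : Type} [Fintype ι] [DecidableEq ι] {V : Opens (ι → ℝ)}
    (a b : ι) (f : SmoothFn V) : pderiv a (pderiv b f) = pderiv b (pderiv a f) := by
  refine Subtype.ext (funext fun x => ?_)
  have hf : ContDiffAt ℝ ∞ (zeroExt f) x := (contDiffOn_zeroExt f).contDiffAt
    (V.isOpen.mem_nhds x.2)
  have hd : DifferentiableAt ℝ (fderiv ℝ (zeroExt f)) x :=
    (hf.fderiv_right (m := ∞) (by simp)).differentiableAt (by simp)
  have key : ∀ a b : ι, (pderiv a (pderiv b f)).1 x =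
      fderiv ℝ (fderiv ℝ (zeroExt f)) x (Pi.single a 1) (Pi.single b 1) := by
    intro a b
    rw [pderiv_apply a (pderiv b f) (F := fun y => fderiv ℝ (zeroExt f) y (Pi.single b 1))
      (fun _ => rfl), fderiv_clm_apply hd (differentiableAt_const _)]
    simp
  rw [key, key]
  exact (hf.isSymmSndFDerivAt (by simpa using ENat.LEInfty.out)).eq _ _

namespace SF
variable {ι κ : Type} [Fintype ι] [DecidableEq ι] [DecidableEq κ]

theorem invPow_smul {V : Opens (ι → ℝ)} (α : ZMod 2) (z : ℤˣ) (f : SF V κ) :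
    invPow α (z • f) = z • invPow α f := by
  rw [Units.smul_def, map_zsmul, ← Units.smul_def]

theorem pd_smul {V : Opens (ι → ℝ)} (A : ι ⊕ κ) (z : ℤˣ) (f : SF V κ) :
    pd A (z • f) = z • pd A f := by
  rw [Units.smul_def, map_zsmul, ← Units.smul_def]

theorem inv_smul {V : Opens (ι → ℝ)} (z : ℤˣ) (f : SF V κ) : inv (z • f) = z • inv f := by
  rw [Units.smul_def, map_zsmul, ← Units.smul_def]

theorem pd_comm {V : Opens (ι → ℝ)} (A B : ι ⊕ κ) (f : SF V κ) :
    pd A (pd B f) = (-1 : ℤˣ) ^ (idxParity A * idxParity B) • pd B (pd A f) := by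
  induction f using SF.induction_on with
  | add x y hx hy => simp only [map_add, hx, hy, smul_add]
  | tm f k =>
    rcases A with a | a <;> rcases B with b | b
    · simp [idxParity, pd_inl_tm, SmoothFn.pderiv_comm a b]
    · simp [idxParity, pd_inl_tm, pd_inr_tm]
    · simp [idxParity, pd_inl_tm, pd_inr_tm]
    · simp only [idxParity, mul_one, neg_one_uzpow_one_smul, pd_inr_tm, ← tm_neg]
      rw [CliffordAlgebra.contractLeft_comm]

theorem invPow_pd {V : Opens (ι → ℝ)} (α : ZMod 2) (A : ι ⊕ κ) (f : SF V κ) :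
    invPow α (pd A f) = (-1 : ℤˣ) ^ (α * idxParity A) • pd A (invPow α f) := by
  rcases parity_cases α with rfl | rfl
  · rw [invPow_zero, invPow_zero, zero_mul, neg_one_uzpow_zero_smul]
  · rw [invPow_one, invPow_one, one_mul, inv_pd]

theorem idxParity_xIdx (A : ι ⊕ κ) : idxParity (xIdx A) = idxParity A := by
  rcases A with a | a <;> rfl

theorem xIdx_ne_pIdx (A B : ι ⊕ κ) : xIdx A ≠ pIdx B := by
  rcases A with a | a <;> rcases B with b | b <;> simp [xIdx, pIdx]

variable [Fintype κ] {V : Opens (ι → ℝ)}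

/-! ### The canonical Poisson bracket -/

theorem poisson_eq_momentumDeriv (F G : SF (cot V) (κ ⊕ κ)) :
    poisson F G = ∑ A, (momentumDeriv A F * pd (xIdx A) G -
      pd (xIdx A) (invPow (idxParity A) F) * pd (pIdx A) G) :=
  Finset.sum_congr rfl fun A _ => by rw [momentumDeriv, smul_mul_assoc]

theorem momentumDeriv_smul (A : ι ⊕ κ) (z : ℤˣ) (F : SF (cot V) (κ ⊕ κ)) :
    momentumDeriv A (z • F) = z • momentumDeriv A F := by
  rw [momentumDeriv, momentumDeriv, invPow_smul, pd_smul, smul_comm]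

theorem momentumDeriv_sub (A : ι ⊕ κ) (F G : SF (cot V) (κ ⊕ κ)) :
    momentumDeriv A (F - G) = momentumDeriv A F - momentumDeriv A G := by
  simp only [momentumDeriv, map_sub, smul_sub]

theorem invPow_momentumDeriv (α : ZMod 2) (A : ι ⊕ κ) (F : SF (cot V) (κ ⊕ κ)) :
    invPow α (momentumDeriv A F) =
      (-1 : ℤˣ) ^ (α * idxParity A) • momentumDeriv A (invPow α F) := by
  rw [momentumDeriv, momentumDeriv, invPow_smul, invPow_pd, invPow_invPow, invPow_invPow,
    idxParity_pIdx, smul_comm, add_comm]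

theorem inv_momentumDeriv_of_parity {α : ZMod 2} {F : SF (cot V) (κ ⊕ κ)}
    (hF : inv F = (-1 : ℤˣ) ^ α • F) (A : ι ⊕ κ) :
    inv (momentumDeriv A F) = (-1 : ℤˣ) ^ (idxParity A + α) • momentumDeriv A F := by
  rw [← invPow_one, invPow_momentumDeriv, invPow_one, hF, momentumDeriv_smul, smul_smul, one_mul,
    uzpow_add]

/-- The momentum derivative is a right derivative, hence commutes with left derivatives without
a sign. -/
theorem momentumDeriv_pd_xIdx (A B : ι ⊕ κ) (F : SF (cot V) (κ ⊕ κ)) :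
    momentumDeriv B (pd (xIdx A) F) = pd (xIdx A) (momentumDeriv B F) := by
  rw [momentumDeriv, momentumDeriv, invPow_pd, pd_smul, pd_smul, pd_comm, idxParity_xIdx,
    idxParity_pIdx, smul_smul ((-1 : ℤˣ) ^ (_ * _)), ← uzpow_add, CharTwo.add_self_eq_zero,
    uzpow_zero, one_smul]

theorem momentumDeriv_pd_pIdx (A B : ι ⊕ κ) (F : SF (cot V) (κ ⊕ κ)) :
    momentumDeriv B (pd (pIdx A) F) = pd (pIdx A) (momentumDeriv B F) := by
  rw [momentumDeriv, momentumDeriv, invPow_pd, pd_smul, pd_smul, pd_comm, idxParity_pIdx,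
    idxParity_pIdx, smul_smul ((-1 : ℤˣ) ^ (_ * _)), ← uzpow_add, CharTwo.add_self_eq_zero,
    uzpow_zero, one_smul]

theorem momentumDeriv_comm (A B : ι ⊕ κ) (F : SF (cot V) (κ ⊕ κ)) :
    momentumDeriv B (momentumDeriv A F) =
      (-1 : ℤˣ) ^ (idxParity B * idxParity A) • momentumDeriv A (momentumDeriv B F) := by
  rw [momentumDeriv.eq_def A F, momentumDeriv.eq_def A (momentumDeriv B F), momentumDeriv_smul,
    momentumDeriv_pd_pIdx, invPow_momentumDeriv, pd_smul, smul_comm, smul_smul, smul_smul]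
  congr 1
  rcases parity_cases (idxParity A) with h | h <;>
    rcases parity_cases (idxParity B) with h' | h' <;>
    simp [h, h']

/-- The momentum derivative acts on the Poisson bracket, whose coefficients are constant, as a
graded derivation from the right. -/
theorem momentumDeriv_poisson (B : ι ⊕ κ) (F G : SF (cot V) (κ ⊕ κ)) :
    momentumDeriv B (poisson F G) =
      poisson F (momentumDeriv B G) + poisson (momentumDeriv B F) (invPow (idxParity B) G) := by
  simp only [poisson_eq_momentumDeriv, momentumDeriv_sum, ← Finset.sum_add_distrib]
  refine Finset.sum_congr rfl fun A _ => ?_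
  rw [momentumDeriv_sub, momentumDeriv_mul, momentumDeriv_mul, momentumDeriv_pd_xIdx,
    momentumDeriv_pd_xIdx, momentumDeriv_pd_pIdx, momentumDeriv_comm, invPow_pd, invPow_pd,
    invPow_momentumDeriv, idxParity_xIdx, idxParity_pIdx, pd_smul, mul_comm (idxParity A)]
  simp only [smul_mul_assoc, mul_smul_comm, smul_smul, ← uzpow_add, CharTwo.add_self_eq_zero,
    uzpow_zero, one_smul]
  abel

theorem poisson_mul_right {α : ZMod 2} {F : SF (cot V) (κ ⊕ κ)}
    (hF : inv F = (-1 : ℤˣ) ^ α • F) (G H : SF (cot V) (κ ⊕ κ)) :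
    poisson F (G * H) = poisson F G * H + invPow α G * poisson F H := by
  simp only [poisson_eq_momentumDeriv, Finset.sum_mul, Finset.mul_sum, ← Finset.sum_add_distrib]
  refine Finset.sum_congr rfl fun A _ => ?_
  have h1 := mul_comm_of_parity (inv_momentumDeriv_of_parity hF A) (invPow (idxParity A) G)
  have hF' : inv (invPow (idxParity A) F) = (-1 : ℤˣ) ^ α • invPow (idxParity A) F := by
    rw [invPow_of_parity _ hF, inv_smul, hF, smul_comm]
  have h2 := mul_comm_of_parity (inv_pd_of_parity hF' (xIdx A)) (invPow (idxParity A) G)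
  have h0 : idxParity A + α + idxParity A = α := by
    rw [add_right_comm, CharTwo.add_self_eq_zero, zero_add]
  rw [invPow_invPow, h0] at h1
  rw [idxParity_xIdx, invPow_invPow, h0] at h2
  rw [pd_mul, pd_mul, idxParity_xIdx, idxParity_pIdx, mul_add, mul_add, ← mul_assoc, ← mul_assoc,
    ← mul_assoc, ← mul_assoc, h1, h2]
  simp only [sub_mul, mul_sub, mul_assoc]
  abel

theorem momentumDeriv_of_parity {α : ZMod 2} {F : SF (cot V) (κ ⊕ κ)}
    (hF : inv F = (-1 : ℤˣ) ^ α • F) (A : ι ⊕ κ) :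
    momentumDeriv A F = (-1 : ℤˣ) ^ (idxParity A + idxParity A * α) • pd (pIdx A) F := by
  rw [momentumDeriv, invPow_of_parity _ hF, pd_smul, smul_smul, uzpow_add]

theorem poisson_antisymm {α β : ZMod 2} {F G : SF (cot V) (κ ⊕ κ)}
    (hF : inv F = (-1 : ℤˣ) ^ α • F) (hG : inv G = (-1 : ℤˣ) ^ β • G) :
    poisson F G = -((-1 : ℤˣ) ^ (α * β) • poisson G F) := by
  simp only [poisson_eq_momentumDeriv, Finset.smul_sum, ← Finset.sum_neg_distrib]
  refine Finset.sum_congr rfl fun A _ => ?_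
  have h1 := mul_comm_of_parity (inv_pd_of_parity hF (pIdx A)) (pd (xIdx A) G)
  have h2 := mul_comm_of_parity (inv_pd_of_parity hF (xIdx A)) (pd (pIdx A) G)
  rw [invPow_of_parity _ (inv_pd_of_parity hG _), idxParity_xIdx, idxParity_pIdx,
    smul_mul_assoc] at h1 h2
  rw [momentumDeriv_of_parity hF, momentumDeriv_of_parity hG, invPow_of_parity _ hF,
    invPow_of_parity _ hG, pd_smul, pd_smul, smul_mul_assoc, smul_mul_assoc, smul_mul_assoc,
    smul_mul_assoc, h1, h2]
  rcases parity_cases (idxParity A) with h | h <;> rcases parity_cases α with rfl | rfl <;>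
    rcases parity_cases β with rfl | rfl <;>
    simp [h, CharTwo.add_self_eq_zero] <;> abel

theorem inv_poisson {α β : ZMod 2} {F G : SF (cot V) (κ ⊕ κ)}
    (hF : inv F = (-1 : ℤˣ) ^ α • F) (hG : inv G = (-1 : ℤˣ) ^ β • G) :
    inv (poisson F G) = (-1 : ℤˣ) ^ (α + β) • poisson F G := by
  simp only [poisson_eq_momentumDeriv, map_sum, Finset.smul_sum]
  refine Finset.sum_congr rfl fun A _ => ?_
  rw [map_sub, map_mul, map_mul, inv_momentumDeriv_of_parity hF, invPow_of_parity _ hF, pd_smul,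
    inv_smul, inv_pd_of_parity hF, inv_pd_of_parity hG, inv_pd_of_parity hG, idxParity_xIdx,
    idxParity_pIdx]
  rcases parity_cases (idxParity A) with h | h <;> rcases parity_cases α with rfl | rfl <;>
    rcases parity_cases β with rfl | rfl <;>
    simp [h, CharTwo.add_self_eq_zero] <;> abel

theorem poisson_sum_right {I : Type} (s : Finset I) (F : SF (cot V) (κ ⊕ κ))
    (G : I → SF (cot V) (κ ⊕ κ)) : poisson F (∑ i ∈ s, G i) = ∑ i ∈ s, poisson F (G i) := by
  simp only [poisson_eq_momentumDeriv, map_sum, Finset.mul_sum, ← Finset.sum_sub_distrib]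
  exact Finset.sum_comm

/-- The graded Jacobi identity, in the case where one of the functions comes from the base. -/
theorem poisson_jacobi_pullCot {α β : ZMod 2} {F G : SF (cot V) (κ ⊕ κ)}
    (hF : inv F = (-1 : ℤˣ) ^ α • F) (hG : inv G = (-1 : ℤˣ) ^ β • G) (h : SF V κ) :
    poisson F (poisson G (pullCot h)) = poisson (poisson F G) (pullCot h) +
      (-1 : ℤˣ) ^ (α * β) • poisson G (poisson F (pullCot h)) := by
  have expand : ∀ {α β : ZMod 2} {F G : SF (cot V) (κ ⊕ κ)},
      inv F = (-1 : ℤˣ) ^ α • F → inv G = (-1 : ℤˣ) ^ β • G →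
      poisson F (poisson G (pullCot h)) =
        ∑ B, poisson F (momentumDeriv B G) * pullCot (pd B h) +
        ∑ B, ∑ A, (-1 : ℤˣ) ^ (α * (idxParity B + β)) •
          (momentumDeriv B G * momentumDeriv A F * pullCot (pd A (pd B h))) := by
    intro α β F G hF hG
    rw [poisson_pullCot G, poisson_sum_right, ← Finset.sum_add_distrib]
    refine Finset.sum_congr rfl fun B _ => ?_
    rw [poisson_mul_right hF, invPow_of_parity _ (inv_momentumDeriv_of_parity hG B),
      poisson_pullCot F, Finset.mul_sum]
    simp only [smul_mul_assoc, mul_assoc]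
  -- the terms with second derivatives of `h` agree by symmetry
  have hsnd : ∑ B, ∑ A, (-1 : ℤˣ) ^ (α * (idxParity B + β)) •
        (momentumDeriv B G * momentumDeriv A F * pullCot (pd A (pd B h))) =
      (-1 : ℤˣ) ^ (α * β) • ∑ B, ∑ A, (-1 : ℤˣ) ^ (β * (idxParity B + α)) •
        (momentumDeriv B F * momentumDeriv A G * pullCot (pd A (pd B h))) := by
    rw [Finset.sum_comm, Finset.smul_sum]
    refine Finset.sum_congr rfl fun A _ => ?_
    rw [Finset.smul_sum]
    refine Finset.sum_congr rfl fun B _ => ?_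
    have hz : ∀ (z : ℤˣ) (k : SF V κ), pullCot (z • k) = z • pullCot k := fun z k => by
      rw [Units.smul_def, map_zsmul, ← Units.smul_def]
    rw [mul_comm_of_parity (inv_momentumDeriv_of_parity hG B) (momentumDeriv A F),
      invPow_of_parity _ (inv_momentumDeriv_of_parity hF A), pd_comm A B, hz]
    rcases parity_cases (idxParity A) with hA | hA <;>
      rcases parity_cases (idxParity B) with hB | hB <;>
      rcases parity_cases α with rfl | rfl <;> rcases parity_cases β with rfl | rfl <;>
      simp [hA, hB, CharTwo.add_self_eq_zero]
  have hfst : ∀ B, poisson (momentumDeriv B F) (invPow (idxParity B) G) =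
      -((-1 : ℤˣ) ^ (α * β) • poisson G (momentumDeriv B F)) := by
    intro B
    have hG' : inv (invPow (idxParity B) G) = (-1 : ℤˣ) ^ β • invPow (idxParity B) G := by
      rw [invPow_of_parity _ hG, inv_smul, hG, smul_comm]
    have hs : ∀ z : ℤˣ, poisson (z • G) (momentumDeriv B F) =
        z • poisson G (momentumDeriv B F) := by
      intro z
      simp only [poisson_eq_momentumDeriv, momentumDeriv_smul, invPow_smul, pd_smul,
        smul_mul_assoc, ← smul_sub, Finset.smul_sum]
    rw [poisson_antisymm (inv_momentumDeriv_of_parity hF B) hG', invPow_of_parity _ hG, hs]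
    rcases parity_cases (idxParity B) with hB | hB <;>
      rcases parity_cases α with rfl | rfl <;> rcases parity_cases β with rfl | rfl <;>
      simp [hB, CharTwo.add_self_eq_zero]
  rw [expand hF hG, expand hG hF, hsnd, poisson_pullCot (poisson F G), smul_add, ← add_assoc]
  congr 1
  rw [Finset.smul_sum, ← Finset.sum_add_distrib]
  refine Finset.sum_congr rfl fun B _ => ?_
  rw [momentumDeriv_poisson, hfst, add_mul, neg_mul, smul_mul_assoc]
  abel

end SF
/-! ### Homogeneity in the fibre coordinates -/

namespace SF
variable {ι κ : Type} [Fintype ι] [DecidableEq ι] [Fintype κ] [DecidableEq κ] {V : Opens (ι → ℝ)}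

/-- The Euler operator `∂F/∂p_A p_A` of the cotangent bundle, with right derivatives. -/
def euler (F : SF (cot V) (κ ⊕ κ)) : SF (cot V) (κ ⊕ κ) :=
  ∑ A, momentumDeriv A F * coord (pIdx A)

/-- `F` is homogeneous of degree `k` in the momenta: it is an eigenvector of the Euler operator. -/
def HasDegree (k : ℝ) (F : SF (cot V) (κ ⊕ κ)) : Prop := euler F = k • F

theorem momentumDeriv_real_smul (A : ι ⊕ κ) (r : ℝ) (F : SF (cot V) (κ ⊕ κ)) :
    momentumDeriv A (r • F) = r • momentumDeriv A F := by
  rw [momentumDeriv, momentumDeriv, map_smul, map_smul, smul_comm]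

theorem coord_pIdx_mul (A : ι ⊕ κ) (F : SF (cot V) (κ ⊕ κ)) :
    invPow (idxParity A) F * coord (pIdx A) = coord (pIdx A) * F := by
  rw [mul_comm_of_parity (inv_coord (pIdx A)) F, idxParity_pIdx]

theorem euler_mul (F G : SF (cot V) (κ ⊕ κ)) : euler (F * G) = euler F * G + F * euler G := by
  simp only [euler, Finset.sum_mul, Finset.mul_sum, ← Finset.sum_add_distrib]
  refine Finset.sum_congr rfl fun A _ => ?_
  rw [momentumDeriv_mul, add_mul, mul_assoc, coord_pIdx_mul, mul_assoc, mul_assoc]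

theorem euler_invPow (α : ZMod 2) (F : SF (cot V) (κ ⊕ κ)) :
    euler (invPow α F) = invPow α (euler F) := by
  simp only [euler, map_sum, map_mul]
  refine Finset.sum_congr rfl fun A _ => ?_
  rw [invPow_momentumDeriv, invPow_of_parity α (inv_coord (pIdx A)), idxParity_pIdx,
    smul_mul_smul_comm, ← uzpow_add, CharTwo.add_self_eq_zero, uzpow_zero, one_smul]

theorem euler_pd_xIdx (A : ι ⊕ κ) (F : SF (cot V) (κ ⊕ κ)) :
    euler (pd (xIdx A) F) = pd (xIdx A) (euler F) := by
  simp only [euler, map_sum]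
  refine Finset.sum_congr rfl fun B _ => ?_
  rw [pd_mul, pd_coord, if_neg (xIdx_ne_pIdx A B), mul_zero, add_zero, momentumDeriv_pd_xIdx]

theorem euler_momentumDeriv (A : ι ⊕ κ) (F : SF (cot V) (κ ⊕ κ)) :
    momentumDeriv A (euler F) = euler (momentumDeriv A F) + momentumDeriv A F := by
  have h : ∀ B, momentumDeriv A (momentumDeriv B F * coord (pIdx B)) =
      momentumDeriv B (momentumDeriv A F) * coord (pIdx B) +
        if A = B then momentumDeriv B F else 0 := by
    intro B
    rw [momentumDeriv_mul, momentumDeriv_p, invPow_of_parity _ (inv_coord (pIdx B)),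
      momentumDeriv_comm, idxParity_pIdx, smul_mul_smul_comm, ← uzpow_add,
      CharTwo.add_self_eq_zero, uzpow_zero, one_smul, mul_ite, mul_one, mul_zero]
  rw [euler, momentumDeriv_sum, Finset.sum_congr rfl fun B _ => h B, Finset.sum_add_distrib,
    Finset.sum_ite_eq, if_pos (Finset.mem_univ A), euler]

theorem HasDegree.congr {j k : ℝ} {F : SF (cot V) (κ ⊕ κ)} (hF : HasDegree j F) (h : j = k) :
    HasDegree k F := h ▸ hF

theorem HasDegree.mul {j k : ℝ} {F G : SF (cot V) (κ ⊕ κ)} (hF : HasDegree j F)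
    (hG : HasDegree k G) : HasDegree (j + k) (F * G) := by
  rw [HasDegree, euler_mul, hF, hG, smul_mul_assoc, mul_smul_comm, add_smul]

theorem HasDegree.sum {I : Type} (s : Finset I) {k : ℝ} {F : I → SF (cot V) (κ ⊕ κ)}
    (hF : ∀ i, HasDegree k (F i)) : HasDegree k (∑ i ∈ s, F i) := by
  have h : euler (∑ i ∈ s, F i) = ∑ i ∈ s, euler (F i) := by
    simp only [euler, momentumDeriv_sum, Finset.sum_mul]
    exact Finset.sum_comm
  rw [HasDegree, h, Finset.smul_sum]
  exact Finset.sum_congr rfl fun i _ => hF i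

theorem HasDegree.sub {k : ℝ} {F G : SF (cot V) (κ ⊕ κ)} (hF : HasDegree k F)
    (hG : HasDegree k G) : HasDegree k (F - G) := by
  have h : euler (F - G) = euler F - euler G := by
    simp only [euler, momentumDeriv_sub, sub_mul, Finset.sum_sub_distrib]
  rw [HasDegree, h, hF, hG, smul_sub]

theorem HasDegree.units_smul {k : ℝ} {F : SF (cot V) (κ ⊕ κ)} (hF : HasDegree k F) (z : ℤˣ) :
    HasDegree k (z • F) := by
  have h : euler (z • F) = z • euler F := by
    simp only [euler, momentumDeriv_smul, smul_mul_assoc, Finset.smul_sum]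
  rw [HasDegree, h, hF, smul_comm]

theorem HasDegree.invPow {k : ℝ} {F : SF (cot V) (κ ⊕ κ)} (hF : HasDegree k F) (α : ZMod 2) :
    HasDegree k (invPow α F) := by
  rw [HasDegree, euler_invPow, hF, map_smul]

theorem HasDegree.pd_xIdx {k : ℝ} {F : SF (cot V) (κ ⊕ κ)} (hF : HasDegree k F) (A : ι ⊕ κ) :
    HasDegree k (pd (xIdx A) F) := by
  rw [HasDegree, euler_pd_xIdx, hF, map_smul]

theorem HasDegree.momentumDeriv {k : ℝ} {F : SF (cot V) (κ ⊕ κ)} (hF : HasDegree k F)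
    (A : ι ⊕ κ) : HasDegree (k - 1) (momentumDeriv A F) := by
  rw [HasDegree, eq_sub_of_add_eq (euler_momentumDeriv A F).symm, hF, momentumDeriv_real_smul,
    sub_smul, one_smul]

theorem pd_pIdx_eq_momentumDeriv (A : ι ⊕ κ) (F : SF (cot V) (κ ⊕ κ)) :
    pd (pIdx A) F =
      (-1 : ℤˣ) ^ idxParity A • SF.momentumDeriv A (SF.invPow (idxParity A) F) := by
  rw [SF.momentumDeriv, invPow_invPow, CharTwo.add_self_eq_zero, invPow_zero, smul_smul,
    ← uzpow_add, CharTwo.add_self_eq_zero, uzpow_zero, one_smul]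

theorem HasDegree.pd_pIdx {k : ℝ} {F : SF (cot V) (κ ⊕ κ)} (hF : HasDegree k F) (A : ι ⊕ κ) :
    HasDegree (k - 1) (pd (pIdx A) F) := by
  rw [pd_pIdx_eq_momentumDeriv]
  exact ((hF.invPow _).momentumDeriv A).units_smul _

theorem HasDegree.poisson {j k : ℝ} {F G : SF (cot V) (κ ⊕ κ)} (hF : HasDegree j F)
    (hG : HasDegree k G) : HasDegree (j + k - 1) (poisson F G) := by
  rw [poisson_eq_momentumDeriv]
  refine HasDegree.sum _ fun A => HasDegree.sub ?_ ?_
  · exact ((hF.momentumDeriv A).mul (hG.pd_xIdx A)).congr (by ring)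
  · exact (((hF.invPow _).pd_xIdx A).mul (hG.pd_pIdx A)).congr (by ring)

theorem hasDegree_pullCot (f : SF V κ) : HasDegree 0 (pullCot f) := by
  simp [HasDegree, euler, momentumDeriv_pullCot]

theorem hasDegree_p (A : ι ⊕ κ) : HasDegree 1 (coord (pIdx A) : SF (cot V) (κ ⊕ κ)) := by
  rw [HasDegree, euler, Finset.sum_eq_single A]
  · rw [momentumDeriv_p, if_pos rfl, one_mul, one_smul]
  · intro B _ hB
    rw [momentumDeriv_p, if_neg hB, zero_mul]
  · simp

theorem poisson_coord (A : ι ⊕ κ) (F : SF (cot V) (κ ⊕ κ)) :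
    poisson F (pullCot (coord A)) = momentumDeriv A F := by
  rw [poisson_pullCot, Finset.sum_eq_single A]
  · rw [pd_coord, if_pos rfl, map_one, mul_one]
  · intro B _ hB
    rw [pd_coord, if_neg hB, map_zero, mul_zero]
  · simp

/-- By Euler's identity, a function of nonzero degree in the momenta vanishes if it Poisson
commutes with the coordinates of the base. -/
theorem HasDegree.eq_zero {k : ℝ} (hk : k ≠ 0) {F : SF (cot V) (κ ⊕ κ)} (hF : HasDegree k F)
    (h : ∀ A, SF.poisson F (pullCot (coord A)) = 0) : F = 0 := by
  refine (smul_eq_zero_iff_right hk).1 (hF.symm.trans (Finset.sum_eq_zero fun A _ => ?_))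
  rw [← poisson_coord, h, zero_mul]

end SF
/-! ### Localization -/

namespace Supermanifold
open SuperSpace
variable {m n : ℕ} {M : Supermanifold.{u} m n}

theorem exists_glue {U V : Opens M.space} (hUV : (⊤ : Opens M.space) ≤ U ⊔ V) (s : M.Fun U)
    (t : M.Fun V) (hst : res (inf_le_left : U ⊓ V ≤ U) s = res (inf_le_right : U ⊓ V ≤ V) t) :
    ∃ f : M.C, res le_top f = s ∧ res le_top f = t := by
  let W : Bool → Opens M.space := fun b => bif b then U else V
  let k : ∀ b, M.Fun (W b) := fun b => match b with
    | true => s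
    | false => t
  have hcov : (⊤ : Opens M.space) ≤ iSup W := by
    intro x hx
    rcases hUV hx with h | h
    · exact Opens.mem_iSup.2 ⟨true, h⟩
    · exact Opens.mem_iSup.2 ⟨false, h⟩
  have hk : ∀ b b' : Bool, res (inf_le_left : W b ⊓ W b' ≤ W b) (k b) =
      res (inf_le_right : W b ⊓ W b' ≤ W b') (k b') := by
    intro b b'
    rcases b with _ | _ <;> rcases b' with _ | _
    · rfl
    · have h := congrArg (res (le_inf inf_le_right inf_le_left : V ⊓ U ≤ U ⊓ V)) hst
      rw [res_res, res_res] at h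
      exact h.symm
    · exact hst
    · rfl
  obtain ⟨f, hf, -⟩ := TopCat.Sheaf.existsUnique_gluing' M.sheaf W ⊤ (fun c => homOfLE le_top)
    hcov k (fun b b' => hk b b')
  exact ⟨f, hf true, hf false⟩

/-- Sections over a chart domain extend to global functions after shrinking the domain around a
given point. The extension is the product with a bump function, continued by zero. -/
theorem exists_global_eq_near (c : M.Charts) {x : M.space} (hx : x ∈ c.dom) :
    ∃ (W : Opens M.space) (hW : W ≤ c.dom), x ∈ W ∧
      ∀ u : M.Fun c.dom, ∃ f : M.C, res le_top f = res hW u := by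
  have := M.t2
  obtain ⟨r, hr, hball⟩ := Metric.isOpen_iff.1 c.φ.open_target (c.φ x) (c.φ.map_source hx)
  let β : ContDiffBump (c.φ x) := ⟨r / 4, r / 2, by positivity, by linarith⟩
  have hcb : Metric.closedBall (c.φ x) (r / 2) ⊆ c.φ.target :=
    (Metric.closedBall_subset_ball (by linarith)).trans hball
  have hK : IsClosed (c.φ.symm '' Metric.closedBall (c.φ x) (r / 2)) :=
    ((isCompact_closedBall _ _).image_of_continuousOn
      (c.φ.symm.continuousOn.mono hcb)).isClosed
  let V : Opens M.space := ⟨_, hK.isOpen_compl⟩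
  let W : Opens M.space := ⟨c.φ.source ∩ c.φ ⁻¹' Metric.ball (c.φ x) (r / 4),
    c.φ.isOpen_inter_preimage Metric.isOpen_ball⟩
  have hW : W ≤ c.dom := fun y hy => hy.1
  let b : SmoothFn (img c.φ c.dom) :=
    ⟨fun y => β y, β, β.contDiff.contDiffOn, fun _ => rfl⟩
  let B : M.Fun c.dom := (c.e c.dom le_rfl).symm (SF.tm b 1)
  have hB : ∀ (U : Opens M.space) (hU : U ≤ c.dom), c.e U hU (res hU B) =
      SF.tm (SmoothFn.comap id contDiff_id (img_mono c.φ hU) b) 1 := by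
    intro U hU
    rw [c.e_res c.dom U le_rfl hU, AlgEquiv.apply_symm_apply, SF.res_tm]
  have hBV : res (inf_le_left : c.dom ⊓ V ≤ c.dom) B = 0 := by
    apply (c.e _ inf_le_left).injective
    rw [hB, map_zero]
    have : SmoothFn.comap id contDiff_id (img_mono c.φ (inf_le_left : c.dom ⊓ V ≤ c.dom)) b = 0 := by
      refine Subtype.ext (funext fun y => β.zero_of_le_dist (le_of_not_gt fun hy => ?_))
      exact y.2.2.2 ⟨y.1, le_of_lt hy, rfl⟩
    rw [this, SF.zero_tm]
  have hBW : res hW B = 1 := by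
    apply (c.e _ hW).injective
    rw [hB, map_one]
    have : SmoothFn.comap id contDiff_id (img_mono c.φ hW) b = 1 := by
      refine Subtype.ext (funext fun y => β.one_of_mem_closedBall ?_)
      have h : c.φ (c.φ.symm y.1) ∈ Metric.ball (c.φ x) (r / 4) := y.2.2.2
      rw [c.φ.right_inv y.2.1] at h
      exact Metric.ball_subset_closedBall h
    rw [this]
    rfl
  refine ⟨W, hW, ⟨hx, Metric.mem_ball_self (by positivity)⟩, fun u => ?_⟩
  have hcov : (⊤ : Opens M.space) ≤ c.dom ⊔ V := by
    intro y _
    by_cases hy : y ∈ c.dom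
    · exact Or.inl hy
    · refine Or.inr ?_
      rintro ⟨z, hz, rfl⟩
      exact hy (c.φ.map_target (hcb hz))
  obtain ⟨f, hf, -⟩ := exists_glue hcov (B * u) 0 (by rw [map_mul, hBV, zero_mul, map_zero])
  refine ⟨f, ?_⟩
  rw [← res_res le_top hW, hf, map_mul, hBW, one_mul]

/-- Vanishing of a function on the cotangent bundle can be checked locally on the base. -/
theorem cotFun_eq_zero_of_locally (c : M.Charts) (F : c.CotFun c.dom)
    (h : ∀ x ∈ c.dom, ∃ (W : Opens M.space) (hW : W ≤ c.dom), x ∈ W ∧ c.cotRes hW F = 0) :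
    F = 0 := by
  refine SF.eq_zero_of_ev F fun a => ?_
  have ha : a.1 ∘ Sum.inl ∈ img c.φ c.dom := a.2
  obtain ⟨W, hW, hxW, hF⟩ := h (c.φ.symm (a.1 ∘ Sum.inl)) ha.2
  have haW : a.1 ∈ cot (img c.φ W) := ⟨ha.1, hxW⟩
  have h1 := SF.ev_res (V := cot (img c.φ c.dom)) (V' := cot (img c.φ W))
    (fun _ hz => img_mono c.φ hW hz) ⟨a.1, haW⟩ F
  exact h1.symm.trans ((congrArg _ hF).trans (map_zero _))

theorem pull_x (c : M.Charts) (A : Fin m ⊕ Fin n) :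
    c.pull le_rfl (c.x A) = SF.pullCot (SF.coord A) :=
  congrArg SF.pullCot ((c.e c.dom le_rfl).apply_symm_apply _)

theorem cotRes_poisson (c : M.Charts) {W : Opens M.space} (hW : W ≤ c.dom)
    (F G : c.CotFun c.dom) :
    c.cotRes hW (SF.poisson F G) = SF.poisson (c.cotRes hW F) (c.cotRes hW G) :=
  (SF.poisson_res _ F G).symm

theorem poisson_zero_left (F : M.CotFam) : poisson 0 F = 0 := by
  funext c
  simp [poisson, SF.poisson]

theorem poisson_zero_right (F : M.CotFam) : poisson F 0 = 0 := by
  funext c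
  simp [poisson, SF.poisson]

/-- Poisson brackets with global functions determine those with sections over chart domains. -/
theorem poisson_pull_eq_zero {R : M.CotFam} (h : ∀ f : M.C, poisson R (toCot f) = 0)
    (c : M.Charts) (u : M.Fun c.dom) : SF.poisson (R c) (c.pull le_rfl u) = 0 := by
  refine cotFun_eq_zero_of_locally c _ fun x hx => ?_
  obtain ⟨W, hW, hxW, hext⟩ := exists_global_eq_near c hx
  obtain ⟨f, hf⟩ := hext u
  refine ⟨W, hW, hxW, ?_⟩
  have h1 := congrArg (c.cotRes hW) (congrFun (h f) c)
  rw [Pi.zero_apply, map_zero, poisson, cotRes_poisson, toCot, c.cotRes_pull, res_res, hf] at h1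
  rw [cotRes_poisson, c.cotRes_pull, h1]

theorem eq_zero_of_poisson_toCot {R : M.CotFam} (hR : ∀ c, SF.HasDegree 1 (R c))
    (h : ∀ f : M.C, poisson R (toCot f) = 0) : R = 0 := by
  funext c
  refine (hR c).eq_zero one_ne_zero fun A => ?_
  rw [← pull_x]
  exact poisson_pull_eq_zero h c _

theorem eq_zero_of_poisson_toCot_toCot {T : M.CotFam} (hT : ∀ c, SF.HasDegree 2 (T c))
    (h : ∀ f g : M.C, poisson (poisson T (toCot f)) (toCot g) = 0) : T = 0 := by
  refine funext fun c => (hT c).eq_zero two_ne_zero fun A => ?_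
  rw [← pull_x]
  refine poisson_pull_eq_zero (fun f => ?_) c _
  refine eq_zero_of_poisson_toCot (fun c => ?_) (h f)
  exact ((hT c).poisson (SF.hasDegree_pullCot _)).congr (by norm_num)

end Supermanifold
/-! ### Jacobi vector fields -/

namespace Supermanifold
open SuperSpace
variable {m n : ℕ} {M : Supermanifold.{u} m n}

theorem res_self {U : Opens M.space} (f : M.Fun U) : res le_rfl f = f := by
  change (M.sheaf.obj.map (𝟙 _)).hom f = f
  rw [CategoryTheory.Functor.map_id]
  rfl

theorem toCot_neg (f : M.C) : toCot (-f) = -toCot f := by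
  funext c
  simp [toCot]

theorem toCot_sub (f g : M.C) : toCot (f - g) = toCot f - toCot g := by
  rw [sub_eq_add_neg, toCot_add, toCot_neg, ← sub_eq_add_neg]

theorem toCot_units_smul (z : ℤˣ) (f : M.C) : toCot (z • f) = z • toCot f := by
  funext c
  rw [toCot, res_units_smul, c.pull_units_smul]
  rfl

theorem toCot_zero : toCot (0 : M.C) = 0 := by
  funext c
  simp [toCot]

theorem inv_toCot {φ : ZMod 2} {f : M.C} (hf : HasParity φ f) (c : M.Charts) :
    SF.inv (toCot f c) = (-1 : ℤˣ) ^ φ • toCot f c := by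
  rw [toCot, c.inv_pull, inv_res, hf, res_units_smul, c.pull_units_smul]

theorem poisson_add_right (F G H : M.CotFam) : poisson F (G + H) = poisson F G + poisson F H := by
  funext c
  simp only [poisson, SF.poisson, Pi.add_apply, map_add, mul_add, smul_add,
    ← Finset.sum_add_distrib]
  refine Finset.sum_congr rfl fun A _ => ?_
  abel

theorem poisson_neg_right (F G : M.CotFam) : poisson F (-G) = -poisson F G := by
  rw [eq_neg_iff_add_eq_zero, ← poisson_add_right, neg_add_cancel, poisson_zero_right]

theorem poisson_add_left (F G H : M.CotFam) : poisson (F + G) H = poisson F H + poisson G H := by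
  funext c
  simp only [poisson, SF.poisson, Pi.add_apply, map_add, add_mul, smul_add,
    ← Finset.sum_add_distrib]
  refine Finset.sum_congr rfl fun A _ => ?_
  abel

theorem poisson_neg_left (F G : M.CotFam) : poisson (-F) G = -poisson F G := by
  rw [eq_neg_iff_add_eq_zero, ← poisson_add_left, neg_add_cancel, poisson_zero_left]

theorem poisson_jacobi_toCot {α β : ZMod 2} {F G : M.CotFam}
    (hF : ∀ c, SF.inv (F c) = (-1 : ℤˣ) ^ α • F c) (hG : ∀ c, SF.inv (G c) = (-1 : ℤˣ) ^ β • G c)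
    (h : M.C) :
    poisson F (poisson G (toCot h)) = poisson (poisson F G) (toCot h) +
      (-1 : ℤˣ) ^ (α * β) • poisson G (poisson F (toCot h)) :=
  funext fun c => SF.poisson_jacobi_pullCot (hF c) (hG c) _

namespace VectorField
variable {ε : ZMod 2} (X : VectorField M ε)

theorem inv_symbol (c : M.Charts) : SF.inv (X.symbol c) = (-1 : ℤˣ) ^ ε • X.symbol c := by
  rw [symbol, map_sum, Finset.smul_sum]
  refine Finset.sum_congr rfl fun A _ => ?_
  have hx : HasParity (idxParity A) (c.x A) := by
    have h := c.hasParity_x le_rfl A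
    rwa [res_self] at h
  have hp : SF.inv (c.p A : c.CotFun c.dom) = (-1 : ℤˣ) ^ idxParity A • c.p A :=
    (SF.inv_coord _).trans (by rw [SF.idxParity_pIdx]; rfl)
  rw [map_mul, c.inv_pull, X.parity_app _ _ _ hx, c.pull_units_smul, hp, smul_mul_smul_comm,
    ← uzpow_add, add_assoc, CharTwo.add_self_eq_zero, add_zero]

theorem hasDegree_symbol (c : M.Charts) : SF.HasDegree 1 (X.symbol c) :=
  SF.HasDegree.sum _ fun A =>
    ((SF.hasDegree_pullCot _).mul (SF.hasDegree_p A)).congr (zero_add 1)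

theorem poisson_symbol_toCot (f : M.C) : poisson X.symbol (toCot f) = toCot (X f) := by
  funext c
  rw [poisson, toCot, X.poisson_symbol, X.app_res, toCot]

theorem map_mul_of_parity {φ : ZMod 2} {f : M.C} (hf : HasParity φ f) (g : M.C) :
    X (f * g) = X f * g + (-1 : ℤˣ) ^ (ε * φ) • (f * X g) := X.leibniz ⊤ φ f g hf

theorem map_units_smul (z : ℤˣ) (f : M.C) : X (z • f) = z • X f := by
  rw [Units.smul_def, map_zsmul, ← Units.smul_def]

/-- The bracket of symbols is the symbol of the graded commutator. -/
theorem poisson_symbol_symbol_toCot {δ : ZMod 2} (Y : VectorField M δ) (f : M.C) :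
    poisson (poisson X.symbol Y.symbol) (toCot f) =
      toCot (X (Y f) - (-1 : ℤˣ) ^ (ε * δ) • Y (X f)) := by
  have h := poisson_jacobi_toCot X.inv_symbol Y.inv_symbol f
  rw [Y.poisson_symbol_toCot, X.poisson_symbol_toCot, X.poisson_symbol_toCot,
    Y.poisson_symbol_toCot] at h
  rw [toCot_sub, h, toCot_units_smul, add_sub_cancel_right]

theorem hasDegree_poisson_symbol {k : ℝ} {F : M.CotFam} (hF : ∀ c, SF.HasDegree k (F c))
    (c : M.Charts) : SF.HasDegree k (poisson X.symbol F c) :=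
  ((X.hasDegree_symbol c).poisson (hF c)).congr (by ring)

end VectorField

namespace OddJacobiStructure
variable (J : OddJacobiStructure M)

theorem hasDegree_S (c : M.Charts) : SF.HasDegree 2 (J.S c) := by
  obtain ⟨s, hs⟩ := J.quadratic_S c
  rw [hs]
  refine SF.HasDegree.sum _ fun A => SF.HasDegree.sum _ fun B => ?_
  exact (((SF.hasDegree_pullCot _).mul (SF.hasDegree_p B)).mul (SF.hasDegree_p A)).congr
    (by norm_num)

theorem inv_S (c : M.Charts) : SF.inv (J.S c) = (-1 : ℤˣ) ^ (1 : ZMod 2) • J.S c := by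
  rw [J.odd_S c, neg_one_uzpow_one_smul]

/-- The function `{{S, f}, g}` on `T^*M`, the part of the odd Jacobi bracket that comes from `S`
alone. -/
def biderivation (f g : M.C) : M.CotFam := poisson (poisson J.S (toCot f)) (toCot g)

theorem biderivation_neg_left (f g : M.C) : J.biderivation (-f) g = -J.biderivation f g := by
  rw [biderivation, toCot_neg, poisson_neg_right, poisson_neg_left, biderivation]

theorem toCot_ham (f g : M.C) :
    toCot (J.ham f g) = -J.biderivation f g + toCot (inv f * J.Q g) := by
  have h : J.Q (f * g) = J.Q f * g + inv f * J.Q g := by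
    rw [J.Q.leibniz' ⊤, invPow_one]
  rw [ham, toCot_sub, toCot_bracket, bracketFam, inv_inv, J.Q.poisson_symbol_toCot, h, toCot_add,
    biderivation]
  abel

theorem toCot_bracket_of_parity {φ : ZMod 2} {f : M.C} (hf : HasParity φ f) (g : M.C) :
    toCot (J.bracket f g) =
      (-1 : ℤˣ) ^ (φ + 1) • (J.biderivation f g - toCot (J.Q (f * g))) := by
  rw [toCot_bracket, bracketFam, J.Q.poisson_symbol_toCot, hf, ← biderivation]
  rcases parity_cases φ with rfl | rfl
  · rw [neg_one_uzpow_zero_smul, zero_add, neg_one_uzpow_one_smul]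
    abel
  · rw [neg_one_uzpow_one_smul, CharTwo.add_self_eq_zero, neg_one_uzpow_zero_smul,
      biderivation_neg_left, neg_mul, map_neg, toCot_neg]
    abel

variable {ε : ZMod 2} (X : VectorField M ε)

theorem poisson_symbol_biderivation {φ : ZMod 2} {f : M.C} (hf : HasParity φ f) (g : M.C) :
    poisson X.symbol (J.biderivation f g) =
      poisson (poisson (poisson X.symbol J.S) (toCot f)) (toCot g) +
        (-1 : ℤˣ) ^ ε • J.biderivation (X f) g +
        (-1 : ℤˣ) ^ (ε * (φ + 1)) • J.biderivation f (X g) := by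
  have hSf : ∀ c, SF.inv (poisson J.S (toCot f) c) =
      (-1 : ℤˣ) ^ (1 + φ) • poisson J.S (toCot f) c :=
    fun c => SF.inv_poisson (J.inv_S c) (inv_toCot hf c)
  have hs : ∀ F : M.CotFam, poisson ((-1 : ℤˣ) ^ ε • F) (toCot g) =
      (-1 : ℤˣ) ^ ε • poisson F (toCot g) := by
    intro F
    rcases parity_cases ε with rfl | rfl
    · rw [neg_one_uzpow_zero_smul, neg_one_uzpow_zero_smul]
    · rw [neg_one_uzpow_one_smul, neg_one_uzpow_one_smul, poisson_neg_left]
  rw [biderivation, poisson_jacobi_toCot X.inv_symbol hSf, X.poisson_symbol_toCot,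
    poisson_jacobi_toCot X.inv_symbol J.inv_S, X.poisson_symbol_toCot, poisson_add_left, mul_one,
    hs, add_comm 1 φ]
  rfl

/-- The failure of `X` to be a derivation of the bracket is governed by `{χ, S}` and `[X, Q]`. -/
theorem toCot_bracket_defect {φ : ZMod 2} {f : M.C} (hf : HasParity φ f) (g : M.C) :
    toCot (X (J.bracket f g) -
        (J.bracket (X f) g + (-1 : ℤˣ) ^ (ε * (φ + 1)) • J.bracket f (X g))) =
      (-1 : ℤˣ) ^ (φ + 1) • (poisson (poisson (poisson X.symbol J.S) (toCot f)) (toCot g) -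
        poisson (poisson X.symbol J.Q.symbol) (toCot (f * g))) := by
  have hs : ∀ F : M.CotFam, poisson X.symbol ((-1 : ℤˣ) ^ (φ + 1) • F) =
      (-1 : ℤˣ) ^ (φ + 1) • poisson X.symbol F := by
    intro F
    rcases parity_cases (φ + 1) with h | h <;> rw [h]
    · rw [neg_one_uzpow_zero_smul, neg_one_uzpow_zero_smul]
    · rw [neg_one_uzpow_one_smul, neg_one_uzpow_one_smul, poisson_neg_right]
  have hL : X f * g = X (f * g) - (-1 : ℤˣ) ^ (ε * φ) • (f * X g) := by
    rw [X.map_mul_of_parity hf, add_sub_cancel_right]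
  rw [X.poisson_symbol_symbol_toCot, toCot_sub, toCot_sub, toCot_add, toCot_units_smul,
    toCot_units_smul, ← X.poisson_symbol_toCot, J.toCot_bracket_of_parity hf, hs,
    J.toCot_bracket_of_parity hf, J.toCot_bracket_of_parity (X.parity_app ⊤ φ f hf), hL,
    sub_eq_add_neg (J.biderivation f g), poisson_add_right, poisson_neg_right,
    X.poisson_symbol_toCot, J.poisson_symbol_biderivation X hf, map_sub, J.Q.map_units_smul,
    toCot_sub, toCot_units_smul]
  rcases parity_cases ε with rfl | rfl <;> rcases parity_cases φ with rfl | rfl <;>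
    simp [CharTwo.add_self_eq_zero] <;> abel

/-- The failure of `[X, X_f] = (-1)^X̃ X_{X(f)}` is governed by `{χ, S}` and `[X, Q]`. -/
theorem toCot_ham_defect {φ : ZMod 2} {f : M.C} (hf : HasParity φ f) (g : M.C) :
    toCot (commutator ε (φ + 1) X (J.ham f) g - (-1 : ℤˣ) ^ ε • J.ham (X f) g) =
      -poisson (poisson (poisson X.symbol J.S) (toCot f)) (toCot g) +
        (-1 : ℤˣ) ^ ((ε + 1) * φ) •
          (toCot f * poisson (poisson X.symbol J.Q.symbol) (toCot g)) := by
  have hmul : ∀ f g : M.C, toCot (f * g) = toCot f * toCot g := by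
    intro f g
    funext c
    simp [toCot]
  have hXf : inv (X f) = (-1 : ℤˣ) ^ (ε + φ) • X f := X.parity_app ⊤ φ f hf
  rw [X.poisson_symbol_symbol_toCot, ← hmul, commutator, toCot_sub, toCot_sub, toCot_units_smul,
    toCot_units_smul, ← X.poisson_symbol_toCot (J.ham f g), J.toCot_ham, J.toCot_ham, J.toCot_ham,
    poisson_add_right, poisson_neg_right, X.poisson_symbol_toCot,
    J.poisson_symbol_biderivation X hf, hf, hXf, smul_mul_assoc, smul_mul_assoc, smul_mul_assoc,
    X.map_units_smul, X.map_mul_of_parity hf, mul_sub, mul_smul_comm, toCot_sub,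
    toCot_units_smul, toCot_units_smul, toCot_units_smul, toCot_units_smul, toCot_add,
    toCot_units_smul]
  rcases parity_cases ε with rfl | rfl <;> rcases parity_cases φ with rfl | rfl <;>
    simp [CharTwo.add_self_eq_zero] <;> abel

/-- A vector field is Jacobi if `{χ, S}` and `{χ, 𝒬}` are annihilated by brackets with global
functions. -/
theorem isJacobi_of_homogeneous
    (hS : ∀ (φ : ZMod 2) (f g : M.C), HasParity φ f →
      poisson (poisson (poisson X.symbol J.S) (toCot f)) (toCot g) = 0)
    (hQ : ∀ f : M.C, poisson (poisson X.symbol J.Q.symbol) (toCot f) = 0) : X.IsJacobi J := by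
  refine ⟨eq_zero_of_poisson_toCot_toCot (X.hasDegree_poisson_symbol J.hasDegree_S) fun f g => ?_,
    eq_zero_of_poisson_toCot (X.hasDegree_poisson_symbol J.Q.hasDegree_symbol) hQ⟩
  obtain ⟨f₀, f₁, h₀, h₁, rfl⟩ := exists_add_parity f
  rw [poisson_add_toCot, poisson_add_left, hS 0 f₀ g h₀, hS 1 f₁ g h₁, add_zero]

end OddJacobiStructure

theorem hasParity_one : HasParity 0 (1 : M.C) := by
  rw [HasParity, map_one, neg_one_uzpow_zero_smul]

theorem poisson_toCot_one (F : M.CotFam) : poisson F (toCot 1) = 0 := by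
  funext c
  have h : toCot (1 : M.C) c = 1 := by simp [toCot]
  simp [poisson, SF.poisson, h, SF.pd_one]

namespace VectorField
variable {ε : ZMod 2} (X : VectorField M ε) (J : OddJacobiStructure M)

theorem isJacobi_iff_bracket : X.IsJacobi J ↔ ∀ (φ : ZMod 2) (f g : M.C), HasParity φ f →
    X (J.bracket f g) =
      J.bracket (X f) g + (-1 : ℤˣ) ^ (ε * (φ + 1)) • J.bracket f (X g) := by
  constructor
  · rintro ⟨hS, hQ⟩ φ f g hf
    refine sub_eq_zero.1 (toCot_injective ?_)
    rw [J.toCot_bracket_defect X hf, hS, hQ]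
    simp only [poisson_zero_left, sub_zero, smul_zero, toCot_zero]
  · intro h
    have key : ∀ (φ : ZMod 2) (f g : M.C), HasParity φ f →
        poisson (poisson (poisson X.symbol J.S) (toCot f)) (toCot g) =
          poisson (poisson X.symbol J.Q.symbol) (toCot (f * g)) := by
      intro φ f g hf
      have h1 := J.toCot_bracket_defect X hf g
      rw [sub_eq_zero.2 (h φ f g hf), toCot_zero] at h1
      exact sub_eq_zero.1 ((smul_eq_zero_iff_eq _).1 h1.symm)
    have hQ : ∀ f : M.C, poisson (poisson X.symbol J.Q.symbol) (toCot f) = 0 := by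
      intro f
      -- a constant first argument kills the second order term `{{{χ, S}, 1}, f}`
      have h1 := key 0 1 f hasParity_one
      rwa [poisson_toCot_one, poisson_zero_left, one_mul, eq_comm] at h1
    exact J.isJacobi_of_homogeneous X (fun φ f g hf => (key φ f g hf).trans (hQ _)) hQ

theorem isJacobi_iff_ham : X.IsJacobi J ↔ ∀ (φ : ZMod 2) (f : M.C), HasParity φ f →
    commutator ε (φ + 1) X (J.ham f) = (-1 : ℤˣ) ^ ε • J.ham (X f) := by
  constructor
  · rintro ⟨hS, hQ⟩ φ f hf
    funext g
    refine sub_eq_zero.1 (toCot_injective ?_)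
    rw [Pi.smul_apply, J.toCot_ham_defect X hf, hS, hQ]
    simp only [poisson_zero_left, mul_zero, smul_zero, neg_zero, add_zero, toCot_zero]
  · intro h
    have key : ∀ (φ : ZMod 2) (f g : M.C), HasParity φ f →
        poisson (poisson (poisson X.symbol J.S) (toCot f)) (toCot g) =
          (-1 : ℤˣ) ^ ((ε + 1) * φ) •
            (toCot f * poisson (poisson X.symbol J.Q.symbol) (toCot g)) := by
      intro φ f g hf
      have h1 := J.toCot_ham_defect X hf g
      rw [h φ f hf, Pi.smul_apply, sub_self, toCot_zero] at h1
      exact neg_add_eq_zero.1 h1.symm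
    have hQ : ∀ f : M.C, poisson (poisson X.symbol J.Q.symbol) (toCot f) = 0 := by
      intro f
      -- as before, a constant first argument isolates `[X, Q]`
      have h1 := key 0 1 f hasParity_one
      have hone : toCot (1 : M.C) = 1 := funext fun c => by simp [toCot]
      rwa [poisson_toCot_one, poisson_zero_left, hone, one_mul, mul_zero, neg_one_uzpow_zero_smul,
        eq_comm] at h1
    exact J.isJacobi_of_homogeneous X
      (fun φ f g hf => by rw [key φ f g hf, hQ, mul_zero, smul_zero]) hQ

end VectorField

/-- The homological vector field is a Jacobi vector field: `{𝒬, 𝒬}` is the symbol of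
`[Q, Q] = 2 Q²`. -/
theorem OddJacobiStructure.isJacobi_Q (J : OddJacobiStructure M) : J.Q.IsJacobi J := by
  refine ⟨J.invariance, eq_zero_of_poisson_toCot
    (J.Q.hasDegree_poisson_symbol J.Q.hasDegree_symbol) fun f => ?_⟩
  rw [J.Q.poisson_symbol_symbol_toCot, J.homological, smul_zero, sub_zero, toCot_zero]

end Supermanifold
end SuperGeometry
end

theorem mainTheorem6 {m n : ℕ} (M : SuperGeometry.Supermanifold m n)
    (J : SuperGeometry.Supermanifold.OddJacobiStructure M) :
    (∀ (ε : ZMod 2) (X : SuperGeometry.Supermanifold.VectorField M ε), List.TFAE [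
      X.IsJacobi J,
      ∀ (φ : ZMod 2) (f g : M.C), SuperGeometry.SuperSpace.HasParity φ f →
        X (J.bracket f g) =
          J.bracket (X f) g + (-1 : ℤˣ) ^ (ε * (φ + 1)) • J.bracket f (X g),
      ∀ (φ : ZMod 2) (f : M.C), SuperGeometry.SuperSpace.HasParity φ f →
        SuperGeometry.Supermanifold.commutator ε (φ + 1) X (J.ham f) =
          (-1 : ℤˣ) ^ ε • J.ham (X f)]) ∧
    (∀ (φ : ZMod 2) (f g : M.C), SuperGeometry.SuperSpace.HasParity φ f →
      J.Q (J.bracket f g) = J.bracket (J.Q f) g + (-1 : ℤˣ) ^ (φ + 1) • J.bracket f (J.Q g)) ∧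
    (∀ (φ : ZMod 2) (f : M.C), SuperGeometry.SuperSpace.HasParity φ f →
      SuperGeometry.Supermanifold.commutator 1 (φ + 1) J.Q (J.ham f) = -J.ham (J.Q f)) := by
  refine ⟨fun ε X => ?_, fun φ f g hf => ?_, fun φ f hf => ?_⟩
  · tfae_have 1 ↔ 2 := X.isJacobi_iff_bracket J
    tfae_have 1 ↔ 3 := X.isJacobi_iff_ham J
    tfae_finish
  · have h := (J.Q.isJacobi_iff_bracket J).1 J.isJacobi_Q φ f g hf
    rwa [one_mul] at h
  · have h := (J.Q.isJacobi_iff_ham J).1 J.isJacobi_Q φ f hf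
    rwa [SuperGeometry.neg_one_uzpow_one_smul] at h
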